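/- Let $\mathcal T$ be a finite conforming tetrahedral triangulation of the closure of a domain $\Omega\subset\mathbb R^3$, let $q_0\in\Omega$ be a vertex of $\mathcal T$, and let $M$ be the union of all tetrahedra of $\mathcal T$ that have $q_0$ as a vertex. Let $P_M$ be the space of continuous functions on $M$ that are affine on each tetrahedron $T\subset M$. Let $W_M$ be the space of fields $w=(u^1,u^2,v)\in H^1_0(M)^3\cap C^0(M)^3$ such that on each tetrahedron $T\subset M$ the horizontal components $u^1,u^2$ are affine, and the vertical component $v$ is the sum of an affine function and a multiple of the bubble function (the product of the four barycentric coordinates of $T$). The combination $\mathbb P_1$–$\mathbb P_1$–$\mathbb P_{1,b}$–$\mathbb P_1$ is called regular in $M$ if every $p\in P_M$ with $\int_M p\,\nabla\cdot w=0$ for all $w\in W_M$ is constant on $M$. Let $r_0$ be the vertical line through $q_0$ (parallel to the $z$-axis) and let $\mathcal F$ be the family of all closed vertical semi-planes bounded by $r_0$. A macro-element is a connected union of at least two tetrahedra of $\mathcal T$. We say that $M$ can be split by a finite set $S\subset\mathcal F$ if $M=M_1\cup\dots\cup M_m$ with $m\ge 2$ macro-elements such that $M_i\cap M_j\subset\bigcup_{\Pi\in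 S}\Pi$ for all $i\ne j$, and no semi-plane of $S$ is superfluous, i.e. for each $\Pi_0\in S$ there are $i\neq j$ with $M_i\cap M_j\not\subset\bigcup_{\Pi\in S\setminus\{\Pi_0\}}\Pi$. Then: 1. If $M$ cannot be split by any finite set $S\subset\mathcal F$, then $\mathbb P_1$–$\mathbb P_1$–$\mathbb P_{1,b}$–$\mathbb P_1$ is regular in $M$. 2. If $M$ can be split by a set $\{\Pi_1,\Pi_2\}\subset\mathcal F$ of two distinct semi-planes, and by no set of more than two semi-planes of $\mathcal F$, then $\mathbb P_1$–$\mathbb P_1$–$\mathbb P_{1,b}$–$\mathbb P_1$ is regular in $M$ if and only if $\Pi_1$ and $\Pi_2$ are not aligned, i.e. $\Pi_1\cup\Pi_2$ is not a vertical plane. 3. If $M$ can be split by a set of more than two semi-planes of $\mathcal F$, then $\mathbb P_1$–$\mathbb P_1$–$\mathbb P_{1,b}$–$\mathbb P_1$ is not regular in $M$. -/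

import Mathlib

open MeasureTheory Set Geometry

/-- Euclidean space `ℝ³`; the coordinates `0, 1, 2` are `x, y, z`, and `z` is the vertical one. -/
abbrev E3 : Type := EuclideanSpace ℝ (Fin 3)

/-- The `i`-th vector of the canonical basis of `ℝ³`. -/
noncomputable def axis (i : Fin 3) : E3 := EuclideanSpace.single i 1

/-! ### Tetrahedral meshes and macro-elements -/

/-- The elements of a mesh: its tetrahedra, each given by its set of four vertices. -/
def meshElements (K : SimplicialComplex ℝ E3) : Set (Finset E3) :=
  {s | s ∈ K.faces ∧ s.card = 4}

/-- `K` is a (conforming, finite) tetrahedral triangulation of the closure of the domain `Ω`. -/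
structure IsTetMesh (K : SimplicialComplex ℝ E3) (Ω : Set E3) : Prop where
  isOpen : IsOpen Ω
  isConnected : IsConnected Ω
  finite : K.faces.Finite
  exists_element : ∀ s ∈ K.faces, ∃ t ∈ meshElements K, s ⊆ t
  space_eq : K.space = closure Ω

/-- The region covered by a set of elements. -/
def region (A : Set (Finset E3)) : Set E3 :=
  ⋃ s ∈ A, convexHull ℝ (s : Set E3)

/-- A macro-element of the mesh `K`: a connected set that is the union of at least two elements. -/
def IsMacroElement (K : SimplicialComplex ℝ E3) (M : Set E3) : Prop :=
  IsConnected M ∧ ∃ A : Set (Finset E3), A ⊆ meshElements K ∧ A.Nontrivial ∧ M = region A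

/-- The macro-element centered in `q`: the union of all elements that have `q` as a vertex. -/
def vertexMacro (K : SimplicialComplex ℝ E3) (q : E3) : Set E3 :=
  region {s | s ∈ meshElements K ∧ q ∈ s}

/-! ### Sobolev functions -/

/-- `g` is the weak partial derivative `∂u/∂xᵢ` in the open set `U`. -/
def HasWeakPartial (U : Set E3) (i : Fin 3) (u g : E3 → ℝ) : Prop :=
  ∀ φ : E3 → ℝ, ContDiff ℝ ((⊤ : ℕ∞) : WithTop ℕ∞) φ → HasCompactSupport φ → tsupport φ ⊆ U →
    ∫ x in U, u x * fderiv ℝ φ x (axis i) = - ∫ x in U, g x * φ x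

/-- `g` is the weak gradient of `u` in `U`, and it is square integrable. -/
def HasL2Grad (U : Set E3) (u : E3 → ℝ) (g : Fin 3 → E3 → ℝ) : Prop :=
  ∀ i, MemLp (g i) 2 (volume.restrict U) ∧ HasWeakPartial U i u (g i)

/-- `u ∈ H¹(U)`. -/
def MemH1 (U : Set E3) (u : E3 → ℝ) : Prop :=
  MemLp u 2 (volume.restrict U) ∧ ∃ g, HasL2Grad U u g

/-- `u ∈ H₀¹(M) ∩ C⁰(M)` for a closed region `M`: `u` is continuous on `M`, belongs to `H¹` of the
interior of `M`, and vanishes on the boundary of `M`. -/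
def MemH10C0 (M : Set E3) (u : E3 → ℝ) : Prop :=
  ContinuousOn u M ∧ MemH1 (interior M) u ∧ ∀ x ∈ frontier M, u x = 0

/-! ### Finite element spaces on a macro-element -/

/-- `f` is a polynomial of degree at most one on the tetrahedron with vertex set `s`. -/
def IsP1On (s : Finset E3) (f : E3 → ℝ) : Prop :=
  ∃ ℓ : E3 →ᵃ[ℝ] ℝ, ∀ x ∈ convexHull ℝ (s : Set E3), f x = ℓ x

/-- `lam v`, for `v ∈ s`, are the barycentric coordinates of the tetrahedron with vertex set `s`:
`lam v` is the affine function with value `1` at `v` and `0` at the other vertices. -/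
def IsBarycentric (s : Finset E3) (lam : E3 → E3 →ᵃ[ℝ] ℝ) : Prop :=
  ∀ v ∈ s, lam v v = 1 ∧ ∀ w ∈ s, w ≠ v → lam v w = 0

/-- `f` is on the tetrahedron `s` the sum of a polynomial of degree at most one and a multiple of
the bubble function, the product of the four barycentric coordinates. -/
def IsP1bOn (s : Finset E3) (f : E3 → ℝ) : Prop :=
  ∃ (ℓ : E3 →ᵃ[ℝ] ℝ) (β : ℝ) (lam : E3 → E3 →ᵃ[ℝ] ℝ), IsBarycentric s lam ∧
    ∀ x ∈ convexHull ℝ (s : Set E3), f x = ℓ x + β * ∏ v ∈ s, lam v x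

/-- The pressure space `P_M`: continuous functions on `M`, `P1` on every element in `M`. -/
def MemPressure (K : SimplicialComplex ℝ E3) (M : Set E3) (p : E3 → ℝ) : Prop :=
  ContinuousOn p M ∧ ∀ s ∈ meshElements K, convexHull ℝ (s : Set E3) ⊆ M → IsP1On s p

/-- The velocity space `W_M` of the combination P1–P1–P1b: fields in `H₀¹(M)³ ∩ C⁰(M)³` whose
horizontal components are `P1` and whose vertical component is `P1b` on every element in `M`. -/
def MemVelocity (K : SimplicialComplex ℝ E3) (M : Set E3) (w : Fin 3 → E3 → ℝ) : Prop :=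
  (∀ i, MemH10C0 M (w i)) ∧
    ∀ s ∈ meshElements K, convexHull ℝ (s : Set E3) ⊆ M →
      IsP1On s (w 0) ∧ IsP1On s (w 1) ∧ IsP1bOn s (w 2)

/-- The set `N_M` of the pressures `p ∈ P_M` with `∫_M p (div w) = 0` for all `w ∈ W_M`. Here
`g j i` is the weak derivative `∂wⱼ/∂xᵢ`. -/
def MemKernel (K : SimplicialComplex ℝ E3) (M : Set E3) (p : E3 → ℝ) : Prop :=
  MemPressure K M p ∧
    ∀ w : Fin 3 → E3 → ℝ, MemVelocity K M w →
      ∀ g : Fin 3 → Fin 3 → E3 → ℝ, (∀ j, HasL2Grad (interior M) (w j) (g j)) →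
        ∫ x in M, p x * ∑ i, g i i x = 0

/-- The combination P1–P1–P1b–P1 is regular in `M`: `N_M` consists only of functions that are
constant on `M`. -/
def IsRegularP1P1P1bP1 (K : SimplicialComplex ℝ E3) (M : Set E3) : Prop :=
  ∀ p, MemKernel K M p → ∃ c : ℝ, ∀ x ∈ M, p x = c

/-! ### Vertical semi-planes and splittings -/

/-- `d` is the direction of a horizontal ray. -/
def IsHorizontal (d : E3) : Prop := d ≠ 0 ∧ d 2 = 0

/-- The closed vertical semi-plane bounded by the vertical line through `q`, on the side of `d`. -/
def verticalSemiplane (q d : E3) : Set E3 :=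
  {x | ∃ s t : ℝ, 0 ≤ s ∧ x = q + s • d + t • axis 2}

/-- The vertical plane through `q` that contains the direction `d`. -/
def verticalPlane (q d : E3) : Set E3 :=
  {x | ∃ s t : ℝ, x = q + s • d + t • axis 2}

/-- The family of the vertical semi-planes bounded by the vertical line through `q`. -/
def semiplaneFamily (q : E3) : Set (Set E3) :=
  {P | ∃ d, IsHorizontal d ∧ P = verticalSemiplane q d}

/-- `M` can be split by the (finite) set `S` of semi-planes: `M` is the union of `m ≥ 2`
macro-elements, composed of elements of the mesh, any two of which meet only within the semi-planes
of `S`, and each semi-plane of `S` takes part in the splitting, i.e. the remaining ones do not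
suffice to separate these macro-elements. -/
def IsSplitBy (K : SimplicialComplex ℝ E3) (M : Set E3) (S : Finset (Set E3)) : Prop :=
  ∃ (m : ℕ) (N : Fin m → Set E3), 2 ≤ m ∧ (∀ i, IsMacroElement K (N i)) ∧ ⋃ i, N i = M ∧
    (∀ i j, i ≠ j → N i ∩ N j ⊆ ⋃₀ (S : Set (Set E3))) ∧
    ∀ P ∈ S, ∃ i j, i ≠ j ∧ ¬ N i ∩ N j ⊆ ⋃₀ ((S : Set (Set E3)) \ {P})

/-- Two semi-planes bounded by the vertical line through `q` are aligned: together they form a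
vertical plane. -/
def AreAligned (q : E3) (P Q : Set E3) : Prop :=
  ∃ d, IsHorizontal d ∧ P ∪ Q = verticalPlane q d

/-!
After integration by parts, a pressure `p` belongs to the kernel of the divergence form on `M` if
and only if `∑ᵢ ∫ ∂ᵢp wᵢ = 0` for all velocities `w`. Here Lipschitz functions suffice: piecewise
smooth functions that vanish on the boundary of `M` have Lipschitz extensions by zero, and the
derivative of a Lipschitz function with compact support has mean zero
(`PiecewiseC1.integral_mul_lineDeriv`); weak gradients are unique (`HasL2Grad.ae_eq`), so the weak
gradients in the definition of the kernel are the piecewise ones (`integral_mul_div_eq`). The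
vertices other than `q` lie on the boundary of `M`, so the horizontal components of a velocity are
multiples of the hat function `φ` of `q` (`eq_mul_hat`), and the bubbles show that `∂₂p = 0` on each
element (`MemKernel.linear_axis_two`). Thus the kernel consists of the pressures that are constant
along vertical lines and satisfy `∫ ∂₀p φ = ∫ ∂₁p φ = 0`
(`memKernel_of_integral_eq_zero`). In particular an affine element of the kernel is constant
(`MemKernel.const_of_affine`).

A pressure that is constant along vertical lines is, up to a constant, a positively homogeneous
piecewise linear function of the two horizontal coordinates. It is linear in sectors that are
bounded by rays, and the vertical semi-planes over these rays cannot cross the interior of an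
element: they are contained in the two-dimensional skeleton of the mesh (`InSkeleton`). A function
that is linear off two rays with independent directions is linear (`exists_linearMap_of_two_rays`),
so a pressure that is not affine has a crease outside any two semi-planes that are not aligned
(`MemPressure.exists_inSkeleton`). Conversely, if `∑ c d • d = 0` is a nontrivial relation between
the directions of semi-planes in the skeleton, then `∑ c d * det (d, u) * arg (-u / d)` is a
continuous function, linear in each sector, with a crease along each ray with `c d ≠ 0`
(`creaseFun`); subtracting a linear function so as to satisfy the two remaining conditions yields a
nonconstant element of the kernel (`IsSkeletonFan.not_isRegular`). Such relations exist for three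
semi-planes and for two aligned ones.

The link with splittings is that two or more semi-planes in the skeleton split `M` into sectors
(`IsSkeletonFan.isSplitBy`), and that each semi-plane of a splitting by two or more is contained in
the skeleton (`inSkeleton_of_isSplitBy`).
-/


/-! ### Geometry of the elements -/

/-- The elements of the mesh `K` that have `q` as a vertex. -/
def vertexStar (K : SimplicialComplex ℝ E3) (q : E3) : Set (Finset E3) :=
  {s | s ∈ meshElements K ∧ q ∈ s}

theorem vertexMacro_eq (K : SimplicialComplex ℝ E3) (q : E3) :
    vertexMacro K q = region (vertexStar K q) := rfl

/-- The vertices of an element, as an affine basis of the space. -/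
noncomputable def elementBasis {K : SimplicialComplex ℝ E3} {s : Finset E3}
    (hs : s ∈ meshElements K) : AffineBasis s ℝ E3 where
  toFun := Subtype.val
  ind' := K.indep hs.1
  tot' := by
    rw [(K.indep hs.1).affineSpan_eq_top_iff_card_eq_finrank_add_one]
    simp [hs.2]

/-- The barycentric coordinate of an element with respect to its vertex `v`; zero if `v` is not a
vertex of the element. -/
noncomputable def bary {K : SimplicialComplex ℝ E3} {s : Finset E3}
    (hs : s ∈ meshElements K) (v : E3) : E3 →ᵃ[ℝ] ℝ :=
  open Classical in if h : v ∈ s then (elementBasis hs).coord ⟨v, h⟩ else AffineMap.const ℝ E3 0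

section bary

variable {K : SimplicialComplex ℝ E3} {s t : Finset E3}

theorem bary_self (hs : s ∈ meshElements K) {v : E3} (hv : v ∈ s) : bary hs v v = 1 := by
  rw [bary, dif_pos hv]
  exact (elementBasis hs).coord_apply_eq ⟨v, hv⟩

theorem bary_ne (hs : s ∈ meshElements K) {v w : E3} (hw : w ∈ s) (h : w ≠ v) :
    bary hs v w = 0 := by
  by_cases hv : v ∈ s
  · rw [bary, dif_pos hv]
    exact (elementBasis hs).coord_apply_ne (i := ⟨v, hv⟩) (j := ⟨w, hw⟩)
      (by simpa [Subtype.ext_iff] using h.symm)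
  · simp [bary, hv]

theorem isBarycentric_bary (hs : s ∈ meshElements K) : IsBarycentric s (bary hs) :=
  fun _ hv => ⟨bary_self hs hv, fun _ hw h => bary_ne hs hw h⟩

theorem convexHull_eq_bary (hs : s ∈ meshElements K) :
    convexHull ℝ (s : Set E3) = {x | ∀ v ∈ s, 0 ≤ bary hs v x} := by
  have := (elementBasis hs).convexHull_eq_nonneg_coord
  have hr : Set.range (elementBasis hs) = (s : Set E3) := Subtype.range_val
  rw [hr] at this
  rw [this]
  ext x
  simp only [mem_ofPred_eq, Subtype.forall]
  refine forall₂_congr fun v hv => ?_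
  rw [bary, dif_pos hv]

theorem interior_convexHull_eq_bary (hs : s ∈ meshElements K) :
    interior (convexHull ℝ (s : Set E3)) = {x | ∀ v ∈ s, 0 < bary hs v x} := by
  have := (elementBasis hs).interior_convexHull
  have hr : Set.range (elementBasis hs) = (s : Set E3) := Subtype.range_val
  rw [hr] at this
  rw [this]
  ext x
  simp only [mem_ofPred_eq, Subtype.forall]
  refine forall₂_congr fun v hv => ?_
  rw [bary, dif_pos hv]

theorem interior_convexHull_nonempty (hs : s ∈ meshElements K) :
    (interior (convexHull ℝ (s : Set E3))).Nonempty := by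
  have := (elementBasis hs).centroid_mem_interior_convexHull
  have hr : Set.range (elementBasis hs) = (s : Set E3) := Subtype.range_val
  rw [hr] at this
  exact ⟨_, this⟩

theorem affineMap_ext_of_element (hs : s ∈ meshElements K) {f g : E3 →ᵃ[ℝ] ℝ}
    (h : ∀ v ∈ s, f v = g v) : f = g := by
  refine AffineMap.ext_on (elementBasis hs).tot ?_
  rintro _ ⟨⟨v, hv⟩, rfl⟩
  exact h v hv

theorem affineMap_apply_eq_sum (hs : s ∈ meshElements K) (f : E3 →ᵃ[ℝ] ℝ) (x : E3) :
    f x = ∑ v ∈ s, f v * bary hs v x := by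
  have hsum : ∀ (t : Finset E3) (g : E3 → E3 →ᵃ[ℝ] ℝ) (y : E3),
      (∑ v ∈ t, g v) y = ∑ v ∈ t, g v y := by
    classical
    intro t g y
    induction t using Finset.induction_on with
    | empty => simp
    | insert a t ha ih => rw [Finset.sum_insert ha, Finset.sum_insert ha, ← ih]; rfl
  have : f = ∑ v ∈ s, f v • bary hs v := by
    refine affineMap_ext_of_element hs fun w hw => ?_
    rw [hsum, Finset.sum_eq_single w]
    · simp [bary_self hs hw]
    · intro v _ hvw
      simp [bary_ne hs hw hvw.symm]
    · exact fun h => absurd hw h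
  conv_lhs => rw [this]
  rw [hsum]
  rfl

theorem affineMap_eqOn_convexHull {A : Set E3} {f g : E3 →ᵃ[ℝ] ℝ} (h : ∀ v ∈ A, f v = g v) :
    ∀ x ∈ convexHull ℝ A, f x = g x := by
  intro x hx
  have hc : Convex ℝ {x | f x = g x} := by
    have : {x | f x = g x} = (f - g) ⁻¹' {0} := by ext; simp [sub_eq_zero]
    rw [this]
    exact (convex_singleton _).affine_preimage _
  exact convexHull_min (fun v hv => h v hv) hc hx

theorem isClosed_element (s : Finset E3) : IsClosed (convexHull ℝ (s : Set E3)) :=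
  s.finite_toSet.isCompact_convexHull ℝ |>.isClosed

theorem isCompact_element (s : Finset E3) : IsCompact (convexHull ℝ (s : Set E3)) :=
  s.finite_toSet.isCompact_convexHull ℝ

theorem element_subset_closure_interior (hs : s ∈ meshElements K) :
    convexHull ℝ (s : Set E3) ⊆ closure (interior (convexHull ℝ (s : Set E3))) := by
  rw [(convex_convexHull ℝ _).closure_interior_eq_closure_of_nonempty_interior
    (interior_convexHull_nonempty hs)]
  exact subset_closure

/-- The interior of an element meets no other element: a point common to both is a combination of
the common vertices, while all barycentric coordinates of an interior point are positive. -/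
theorem subset_of_mem_interior (hs : s ∈ meshElements K) (ht : t ∈ meshElements K) {x : E3}
    (hx : x ∈ interior (convexHull ℝ (s : Set E3))) (hxt : x ∈ convexHull ℝ (t : Set E3)) :
    s = t := by
  have hst : s ⊆ t := by
    intro v hv
    by_contra hvt
    have h1 := K.inter_subset_convexHull hs.1 ht.1 ⟨interior_subset hx, hxt⟩
    have h2 : bary hs v x = (AffineMap.const ℝ E3 (0 : ℝ)) x := by
      refine affineMap_eqOn_convexHull (A := (s ∩ t : Set E3)) (fun w hw => ?_) x h1
      exact bary_ne hs hw.1 (fun h => hvt (h ▸ hw.2))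
    rw [interior_convexHull_eq_bary hs] at hx
    have := hx v hv
    simp [h2] at this
  exact Finset.eq_of_subset_of_card_le hst (by rw [hs.2, ht.2])

theorem bary_eq_of_mem (hs : s ∈ meshElements K) (ht : t ∈ meshElements K) {v x : E3}
    (hv : v ∈ s) (hvt : v ∈ t)
    (hx : x ∈ convexHull ℝ (s : Set E3)) (hxt : x ∈ convexHull ℝ (t : Set E3)) :
    bary hs v x = bary ht v x := by
  refine affineMap_eqOn_convexHull (A := (s ∩ t : Set E3)) (fun w hw => ?_) x
    (K.inter_subset_convexHull hs.1 ht.1 ⟨hx, hxt⟩)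
  by_cases h : w = v
  · subst h; rw [bary_self hs hv, bary_self ht hvt]
  · rw [bary_ne hs hw.1 h, bary_ne ht hw.2 h]

end bary

theorem tendsto_add_smul {E : Type*} [NormedAddCommGroup E] [NormedSpace ℝ E] (x v : E) :
    Filter.Tendsto (fun t : ℝ => x + t • v) (nhdsWithin 0 (Ioi 0)) (nhds x) := by
  refine Filter.Tendsto.mono_left ?_ nhdsWithin_le_nhds
  have : Continuous (fun t : ℝ => x + t • v) := by fun_prop
  simpa using this.tendsto 0

/-! ### The macro-element centred in an interior vertex -/

/-- The vertex `q` is surrounded by the finitely many elements of the mesh that contain it. -/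
structure IsInteriorVertex (K : SimplicialComplex ℝ E3) (q : E3) : Prop where
  finite : (vertexStar K q).Finite
  mem_nhds : vertexMacro K q ∈ nhds q

theorem mem_vertexMacro {K : SimplicialComplex ℝ E3} {q x : E3} :
    x ∈ vertexMacro K q ↔ ∃ s ∈ vertexStar K q, x ∈ convexHull ℝ (s : Set E3) := by
  simp [vertexMacro_eq, region]

theorem vertex_mem_of_mem_convexHull {K : SimplicialComplex ℝ E3} {s t : Finset E3} {v : E3}
    (hs : s ∈ meshElements K) (ht : t ∈ meshElements K) (hv : v ∈ s)
    (h : v ∈ convexHull ℝ (t : Set E3)) : v ∈ t := by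
  by_contra hvt
  have h1 := K.inter_subset_convexHull hs.1 ht.1 ⟨subset_convexHull ℝ _ hv, h⟩
  have h2 : bary hs v v = (AffineMap.const ℝ E3 (0 : ℝ)) v := by
    refine affineMap_eqOn_convexHull (A := (s ∩ t : Set E3)) (fun w hw => ?_) v h1
    exact bary_ne hs hw.1 (fun h => hvt (h ▸ hw.2))
  simp [bary_self hs hv] at h2

theorem IsTetMesh.isInteriorVertex {K : SimplicialComplex ℝ E3} {Ω : Set E3}
    (hK : IsTetMesh K Ω) {q : E3} (hq : q ∈ K.vertices) (hqΩ : q ∈ Ω) :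
    IsInteriorVertex K q := by
  obtain ⟨s₀, hs₀, hqs₀⟩ := hK.exists_element _ hq
  have hqs₀ : q ∈ s₀ := hqs₀ (Finset.mem_singleton_self q)
  have hfin : (meshElements K).Finite := hK.finite.subset fun s hs => hs.1
  refine ⟨hfin.subset fun s hs => hs.1, ?_⟩
  have hcl : IsClosed (region {s | s ∈ meshElements K ∧ q ∉ s}) :=
    (hfin.subset fun s hs => hs.1).isClosed_biUnion fun s _ => isClosed_element s
  have hqn : q ∉ region {s | s ∈ meshElements K ∧ q ∉ s} := by
    simp only [region, mem_iUnion, not_exists]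
    intro s hs hqs
    exact hs.2 (vertex_mem_of_mem_convexHull hs₀ hs.1 hqs₀ hqs)
  filter_upwards [hK.isOpen.mem_nhds hqΩ, hcl.isOpen_compl.mem_nhds hqn] with x hxΩ hxn
  have hx : x ∈ K.space := hK.space_eq ▸ subset_closure hxΩ
  obtain ⟨f, hf, hxf⟩ := SimplicialComplex.mem_space_iff.1 hx
  obtain ⟨s, hs, hfs⟩ := hK.exists_element f hf
  have hxs : x ∈ convexHull ℝ (s : Set E3) := convexHull_mono (by exact_mod_cast hfs) hxf
  refine mem_vertexMacro.2 ⟨s, ⟨hs, ?_⟩, hxs⟩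
  by_contra hqs
  exact hxn (by simp only [region, mem_iUnion]; exact ⟨s, ⟨hs, hqs⟩, hxs⟩)

section vertexStar

variable {K : SimplicialComplex ℝ E3} {q : E3} {s : Finset E3}

theorem element_subset_vertexMacro (hs : s ∈ vertexStar K q) :
    convexHull ℝ (s : Set E3) ⊆ vertexMacro K q := fun _ hx => mem_vertexMacro.2 ⟨s, hs, hx⟩

theorem mem_vertexStar_of_subset (hs : s ∈ meshElements K)
    (h : convexHull ℝ (s : Set E3) ⊆ vertexMacro K q) : s ∈ vertexStar K q := by
  obtain ⟨x, hx⟩ := interior_convexHull_nonempty hs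
  obtain ⟨t, ht, hxt⟩ := mem_vertexMacro.1 (h (interior_subset hx))
  exact subset_of_mem_interior hs ht.1 hx hxt ▸ ht

theorem center_mem_element (hs : s ∈ vertexStar K q) : q ∈ convexHull ℝ (s : Set E3) :=
  subset_convexHull ℝ _ hs.2

/-- Elements around `q` are star-shaped with respect to `q`. -/
theorem homothety_mem (hs : s ∈ vertexStar K q) {x : E3}
    (hx : x ∈ convexHull ℝ (s : Set E3)) {t : ℝ} (h0 : 0 ≤ t) (h1 : t ≤ 1) : q + t • (x - q) ∈ convexHull ℝ (s : Set E3) :=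
  (convex_convexHull ℝ _).add_smul_sub_mem (center_mem_element hs) hx ⟨h0, h1⟩

theorem homothety_mem_interior (hs : s ∈ vertexStar K q) {x : E3}
    (hx : x ∈ interior (convexHull ℝ (s : Set E3))) {t : ℝ}
    (h0 : 0 < t) (h1 : t ≤ 1) : q + t • (x - q) ∈ interior (convexHull ℝ (s : Set E3)) :=
  (convex_convexHull ℝ _).add_smul_sub_mem_interior (center_mem_element hs) hx ⟨h0, h1⟩

theorem isCompact_vertexMacro (h : IsInteriorVertex K q) : IsCompact (vertexMacro K q) :=
  h.finite.isCompact_biUnion fun s _ => isCompact_element s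

theorem isClosed_vertexMacro (h : IsInteriorVertex K q) : IsClosed (vertexMacro K q) :=
  (isCompact_vertexMacro h).isClosed

theorem affine_homothety (f : E3 →ᵃ[ℝ] ℝ) (x : E3) (t : ℝ) :
    f (q + t • (x - q)) = f q + t * (f x - f q) := by
  have : q + t • (x - q) = AffineMap.lineMap q x t := by
    rw [AffineMap.lineMap_apply, vsub_eq_sub, vadd_eq_add, add_comm]
  rw [this, AffineMap.apply_lineMap, AffineMap.lineMap_apply]
  simp; ring

/-- A vertex opposite to `q` lies on the boundary of the macro-element: the segment from `q` to it
cannot be prolonged within an element. -/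
theorem vertex_mem_frontier (hs : s ∈ vertexStar K q) {v : E3} (hv : v ∈ s) (hvq : v ≠ q) :
    v ∈ frontier (vertexMacro K q) := by
  refine ⟨subset_closure (element_subset_vertexMacro hs (subset_convexHull ℝ _ hv)), fun hint => ?_⟩
  have hc : Filter.Tendsto (fun ε : ℝ => q + (1 + ε) • (v - q)) (nhdsWithin 0 (Ioi 0))
      (nhds v) := by
    refine Filter.Tendsto.mono_left ?_ nhdsWithin_le_nhds
    have : Continuous (fun ε : ℝ => q + (1 + ε) • (v - q)) := by fun_prop
    simpa using this.tendsto 0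
  obtain ⟨ε, hε, hε0⟩ := ((hc.eventually (mem_interior_iff_mem_nhds.1 hint)).and
    self_mem_nhdsWithin).exists
  have hε0 : 0 < ε := hε0
  obtain ⟨t, ht, hyt⟩ := mem_vertexMacro.1 hε
  set y := q + (1 + ε) • (v - q) with hy
  have hvy : v = q + (1 + ε)⁻¹ • (y - q) := by
    rw [hy, add_sub_cancel_left, smul_smul, inv_mul_cancel₀ (by positivity)]; simp
  have hvt : v ∈ convexHull ℝ (t : Set E3) := by
    rw [hvy]
    exact homothety_mem ht hyt (by positivity) (inv_le_one_of_one_le₀ (by linarith))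
  have hvt' := vertex_mem_of_mem_convexHull hs.1 ht.1 hv hvt
  have h0 : bary ht.1 q v = 0 := bary_ne ht.1 hvt' hvq
  have h1 := affine_homothety (q := q) (bary ht.1 q) v (1 + ε)
  rw [← hy, bary_self ht.1 ht.2, h0] at h1
  have h2 : 0 ≤ bary ht.1 q y := by
    rw [convexHull_eq_bary ht.1] at hyt
    exact hyt q ht.2
  linarith

end vertexStar

/-! ### Functions that are Lipschitz on each set of a finite closed cover -/

/-- A function on an interval covered by finitely many closed sets obeys a Lipschitz bound that
holds on each of them: from the left end one can jump to the last point of a set that contains it,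
and the rest of the interval is covered by the other sets. No continuity is needed. -/
theorem abs_sub_le_of_finite_closed_cover {ι : Type*} {A : ι → Set ℝ} (hA : ∀ i, IsClosed (A i))
    {h : ℝ → ℝ} {C : ℝ} (hC : ∀ i, ∀ s ∈ A i, ∀ t ∈ A i, |h t - h s| ≤ C * |t - s|) (b : ℝ)
    (I : Finset ι) :
    ∀ a ≤ b, Icc a b ⊆ ⋃ i ∈ I, A i → |h b - h a| ≤ C * (b - a) := by
  classical
  induction I using Finset.strongInduction with
  | H I ih =>
    intro a hab hcov
    obtain ⟨i, hi, hai⟩ : ∃ i ∈ I, a ∈ A i := by simpa using hcov ⟨le_rfl, hab⟩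
    set B := A i ∩ Icc a b with hB
    have hBne : B.Nonempty := ⟨a, hai, le_rfl, hab⟩
    have hBbd : BddAbove B := ⟨b, fun x hx => hx.2.2⟩
    have ht : sSup B ∈ B := ((hA i).inter isClosed_Icc).csSup_mem hBne hBbd
    set t := sSup B with htdef
    have h1 : |h t - h a| ≤ C * (t - a) := by
      have := hC i a hai t ht.1
      rwa [abs_of_nonneg (sub_nonneg.2 ht.2.1)] at this
    rcases eq_or_lt_of_le ht.2.2 with htb | htb
    · rwa [htb] at h1
    · have hsub : Icc t b ⊆ ⋃ j ∈ I.erase i, A j := by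
        have hcl : IsClosed (⋃ j ∈ I.erase i, A j) := isClosed_biUnion_finset fun j _ => hA j
        rw [← closure_Ioc htb.ne]
        refine closure_minimal (fun x hx => ?_) hcl
        obtain ⟨j, hj, hxj⟩ : ∃ j ∈ I, x ∈ A j := by
          simpa using hcov ⟨ht.2.1.trans hx.1.le, hx.2⟩
        have hji : j ≠ i := by
          rintro rfl
          exact absurd (le_csSup hBbd ⟨hxj, ht.2.1.trans hx.1.le, hx.2⟩) (not_le.2 hx.1)
        simp only [mem_iUnion]
        exact ⟨j, Finset.mem_erase.2 ⟨hji, hj⟩, hxj⟩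
      have h2 := ih _ (Finset.erase_ssubset hi) t htb.le hsub
      calc |h b - h a| = |(h b - h t) + (h t - h a)| := by ring_nf
        _ ≤ |h b - h t| + |h t - h a| := abs_add_le _ _
        _ ≤ C * (b - t) + C * (t - a) := add_le_add h2 h1
        _ = C * (b - a) := by ring

theorem exists_lipschitzWith_of_finite_closed_cover {ι E : Type*} [NormedAddCommGroup E]
    [NormedSpace ℝ E] (I : Finset ι) {A : ι → Set E} (hA : ∀ i, IsClosed (A i))
    (hcov : ∀ x, ∃ i ∈ I, x ∈ A i) {f : E → ℝ} (hf : ∀ i ∈ I, ∃ C, LipschitzOnWith C f (A i)) :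
    ∃ C, LipschitzWith C f := by
  classical
  choose! C hC using hf
  have hC' : ∀ i ∈ I, LipschitzOnWith (I.sup C) f (A i) := fun i hi =>
    (hC i hi).weaken (Finset.le_sup hi)
  refine ⟨I.sup C, LipschitzWith.of_dist_le_mul fun x y => ?_⟩
  set D : ℝ := ((I.sup C : NNReal) : ℝ) with hD
  let g : ℝ → E := fun t => x + t • (y - x)
  have hg : Continuous g := by fun_prop
  have hgd : ∀ s t, dist (g t) (g s) = |t - s| * dist x y := by
    intro s t
    simp only [g, dist_add_left]
    rw [dist_eq_norm, ← sub_smul, norm_smul, Real.norm_eq_abs, dist_comm x y, dist_eq_norm]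
  have key := abs_sub_le_of_finite_closed_cover (ι := {i // i ∈ I})
    (A := fun i => g ⁻¹' (A i)) (fun i => (hA i).preimage hg) (h := f ∘ g) (C := D * dist x y)
    (by
      intro i s hs t ht
      have := (hC' i i.2).dist_le_mul (g t) ht (g s) hs
      rw [Real.dist_eq, hgd] at this
      calc _ ≤ D * (|t - s| * dist x y) := this
        _ = _ := by ring) 1 Finset.univ 0 zero_le_one (by
      intro t _
      obtain ⟨i, hi, h⟩ := hcov (g t)
      simp only [mem_iUnion]
      exact ⟨⟨i, hi⟩, Finset.mem_univ _, h⟩)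
  simp only [Function.comp, g, one_smul, zero_smul, add_zero, add_sub_cancel, sub_zero,
    mul_one] at key
  rw [dist_comm (f x), Real.dist_eq]
  exact key

/-! ### Piecewise regular functions on a macro-element -/

section Piecewise

variable {K : SimplicialComplex ℝ E3} {q : E3} {u p f g : E3 → ℝ}

/-- On each element around `q` the function agrees with a `C¹` function. -/
def PiecewiseC1 (K : SimplicialComplex ℝ E3) (q : E3) (u : E3 → ℝ) : Prop :=
  ∀ s ∈ vertexStar K q, ∃ f : E3 → ℝ, ContDiff ℝ 1 f ∧ EqOn u f (convexHull ℝ (s : Set E3))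

/-- On the interior of each element around `q` the function agrees with a continuous function. -/
def PiecewiseCont (K : SimplicialComplex ℝ E3) (q : E3) (u : E3 → ℝ) : Prop :=
  ∀ s ∈ vertexStar K q,
    ∃ f : E3 → ℝ, Continuous f ∧ EqOn u f (interior (convexHull ℝ (s : Set E3)))

theorem PiecewiseC1.mul (hf : PiecewiseC1 K q f) (hg : PiecewiseC1 K q g) :
    PiecewiseC1 K q (fun x => f x * g x) := by
  intro s hs
  obtain ⟨f', hf', h1⟩ := hf s hs
  obtain ⟨g', hg', h2⟩ := hg s hs
  exact ⟨fun x => f' x * g' x, hf'.mul hg', fun x hx => by simp only [h1 hx, h2 hx]⟩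

theorem PiecewiseC1.piecewiseCont (hf : PiecewiseC1 K q f) : PiecewiseCont K q f := by
  intro s hs
  obtain ⟨f', hf', h1⟩ := hf s hs
  exact ⟨f', hf'.continuous, h1.mono interior_subset⟩

theorem PiecewiseCont.mul (hf : PiecewiseCont K q f) (hg : PiecewiseCont K q g) :
    PiecewiseCont K q (fun x => f x * g x) := by
  intro s hs
  obtain ⟨f', hf', h1⟩ := hf s hs
  obtain ⟨g', hg', h2⟩ := hg s hs
  exact ⟨fun x => f' x * g' x, hf'.mul hg', fun x hx => by simp only [h1 hx, h2 hx]⟩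

theorem eventuallyEq_of_eqOn_interior {s : Finset E3} {x : E3}
    (h : EqOn u f (convexHull ℝ (s : Set E3)))
    (hx : x ∈ interior (convexHull ℝ (s : Set E3))) : u =ᶠ[nhds x] f :=
  Filter.eventuallyEq_of_mem (mem_interior_iff_mem_nhds.1 hx) h

theorem PiecewiseC1.lineDeriv (hf : PiecewiseC1 K q f) (v : E3) :
    PiecewiseCont K q (fun x => lineDeriv ℝ f x v) := by
  intro s hs
  obtain ⟨f', hf', h1⟩ := hf s hs
  refine ⟨fun x => fderiv ℝ f' x v, (hf'.continuous_fderiv one_ne_zero).clm_apply continuous_const,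
    fun x hx => ?_⟩
  simp only
  rw [(eventuallyEq_of_eqOn_interior h1 hx).lineDeriv_eq,
    ((hf'.differentiable one_ne_zero) x).lineDeriv_eq_fderiv]

theorem PiecewiseC1.differentiableAt (hf : PiecewiseC1 K q f) {s : Finset E3}
    (hs : s ∈ vertexStar K q) {x : E3} (hx : x ∈ interior (convexHull ℝ (s : Set E3))) :
    DifferentiableAt ℝ f x := by
  obtain ⟨f', hf', h1⟩ := hf s hs
  exact (eventuallyEq_of_eqOn_interior h1 hx).differentiableAt_iff.2
    (hf'.differentiable one_ne_zero x)

theorem PiecewiseC1.lineDeriv_mul (hf : PiecewiseC1 K q f) (hg : PiecewiseC1 K q g)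
    {s : Finset E3} (hs : s ∈ vertexStar K q) {x : E3}
    (hx : x ∈ interior (convexHull ℝ (s : Set E3))) (v : E3) :
    _root_.lineDeriv ℝ (fun y => f y * g y) x v =
      _root_.lineDeriv ℝ f x v * g x + f x * _root_.lineDeriv ℝ g x v := by
  have h1 := hf.differentiableAt hs hx
  have h2 := hg.differentiableAt hs hx
  rw [h1.lineDeriv_eq_fderiv, h2.lineDeriv_eq_fderiv, (h1.fun_mul h2).lineDeriv_eq_fderiv,
    fderiv_fun_mul h1 h2]
  simp; ring

theorem ae_mem_interior_of_mem (h : (vertexStar K q).Finite) :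
    ∀ᵐ x : E3, ∀ s ∈ vertexStar K q, x ∈ convexHull ℝ (s : Set E3) →
      x ∈ interior (convexHull ℝ (s : Set E3)) := by
  rw [ae_ball_iff h.countable]
  intro s _
  have h0 : volume (frontier (convexHull ℝ (s : Set E3))) = 0 :=
    (convex_convexHull ℝ _).addHaar_frontier volume
  filter_upwards [compl_mem_ae_iff.2 h0] with x hx hxs
  by_contra hxi
  exact hx ⟨subset_closure hxs, hxi⟩

theorem ae_exists_mem_interior (h : (vertexStar K q).Finite) :
    ∀ᵐ x : E3, x ∈ vertexMacro K q →
      ∃ s ∈ vertexStar K q, x ∈ interior (convexHull ℝ (s : Set E3)) := by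
  filter_upwards [ae_mem_interior_of_mem h] with x hx hxM
  obtain ⟨s, hs, hxs⟩ := mem_vertexMacro.1 hxM
  exact ⟨s, hs, hx s hs hxs⟩

theorem PiecewiseCont.integrableOn (h : (vertexStar K q).Finite) (hf : PiecewiseCont K q f) :
    IntegrableOn f (vertexMacro K q) := by
  rw [vertexMacro_eq, region, integrableOn_finite_biUnion h]
  intro s hs
  obtain ⟨f', hf', h1⟩ := hf s hs
  have h2 : IntegrableOn f' (convexHull ℝ (s : Set E3)) :=
    hf'.continuousOn.integrableOn_compact (isCompact_element s)
  refine h2.congr ?_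
  filter_upwards [ae_restrict_of_ae (ae_mem_interior_of_mem h),
    ae_restrict_mem (isClosed_element s).measurableSet] with x hx hxs
  exact (h1 (hx s hs hxs)).symm

/-- A piecewise `C¹` function that vanishes on the boundary of the macro-element has a Lipschitz
extension by zero. -/
theorem PiecewiseC1.exists_lipschitzWith (h : IsInteriorVertex K q) (hu : PiecewiseC1 K q u)
    (h0 : ∀ x ∈ frontier (vertexMacro K q), u x = 0) :
    ∃ C, LipschitzWith C (indicator (vertexMacro K q) u) := by
  classical
  refine exists_lipschitzWith_of_finite_closed_cover
    (insert (closure (vertexMacro K q)ᶜ)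
      (h.finite.toFinset.image fun s : Finset E3 => convexHull ℝ (s : Set E3)))
    (A := fun A => closure A) (fun A => isClosed_closure) (fun x => ?_) (fun A hA => ?_)
  · by_cases hx : x ∈ vertexMacro K q
    · obtain ⟨s, hs, hxs⟩ := mem_vertexMacro.1 hx
      exact ⟨_, Finset.mem_insert_of_mem (Finset.mem_image_of_mem _ (h.finite.mem_toFinset.2 hs)),
        subset_closure hxs⟩
    · exact ⟨_, Finset.mem_insert_self _ _, subset_closure (subset_closure hx)⟩
  · rw [Finset.mem_insert, Finset.mem_image] at hA
    rcases hA with rfl | ⟨s, hs, rfl⟩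
    · refine ⟨0, ?_⟩
      have : ∀ x ∈ closure (closure (vertexMacro K q)ᶜ), indicator (vertexMacro K q) u x = 0 := by
        intro x hx
        rw [closure_closure] at hx
        by_cases hxM : x ∈ vertexMacro K q
        · rw [indicator_of_mem hxM]
          exact h0 x (by rw [frontier_eq_closure_inter_closure]; exact ⟨subset_closure hxM, hx⟩)
        · exact indicator_of_notMem hxM _
      intro x hx y hy
      simp [this x hx, this y hy]
    · have hs := h.finite.mem_toFinset.1 hs
      obtain ⟨f, hf, h1⟩ := hu s hs
      obtain ⟨C, hC⟩ := (hf.locallyLipschitz.locallyLipschitzOn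
        (s := convexHull ℝ (s : Set E3))).exists_lipschitzOnWith_of_compact (isCompact_element s)
      refine ⟨C, ?_⟩
      simp only [(isClosed_element s).closure_eq]
      intro x hx y hy
      rw [indicator_of_mem (element_subset_vertexMacro hs hx),
        indicator_of_mem (element_subset_vertexMacro hs hy), h1 hx, h1 hy]
      exact hC hx hy

theorem hasCompactSupport_indicator_vertexMacro (h : IsInteriorVertex K q) :
    HasCompactSupport (indicator (vertexMacro K q) u) :=
  HasCompactSupport.intro (isCompact_vertexMacro h) fun _ hx => indicator_of_notMem hx _

theorem lineDeriv_indicator_of_mem_interior {M : Set E3} {x : E3} (hx : x ∈ interior M) (v : E3) :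
    lineDeriv ℝ (indicator M u) x v = lineDeriv ℝ u x v := by
  refine Filter.EventuallyEq.lineDeriv_eq ?_
  filter_upwards [mem_interior_iff_mem_nhds.1 hx] with y hy using indicator_of_mem hy _

/-- The derivative of a Lipschitz function with compact support has mean zero. -/
theorem PiecewiseC1.integral_lineDeriv_eq_zero (h : IsInteriorVertex K q) (hu : PiecewiseC1 K q u)
    (h0 : ∀ x ∈ frontier (vertexMacro K q), u x = 0) (v : E3) :
    ∫ x in vertexMacro K q, _root_.lineDeriv ℝ u x v = 0 := by
  obtain ⟨C, hC⟩ := hu.exists_lipschitzWith h h0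
  have h1 := LipschitzWith.integral_lineDeriv_mul_eq (μ := volume) (LipschitzWith.const (1 : ℝ)) hC
    (hasCompactSupport_indicator_vertexMacro h) (-v)
  have h2 : ∀ x : E3, _root_.lineDeriv ℝ (fun _ : E3 => (1 : ℝ)) x (-v) = 0 := fun x => by
    simp [_root_.lineDeriv]
  simp only [h2, zero_mul, integral_zero, mul_one, neg_neg] at h1
  rw [← setIntegral_eq_integral_of_forall_compl_eq_zero (s := vertexMacro K q)] at h1
  · rw [h1]
    refine setIntegral_congr_ae (isClosed_vertexMacro h).measurableSet ?_
    filter_upwards [ae_exists_mem_interior h.finite] with x hx hxM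
    obtain ⟨s, hs, hxs⟩ := hx hxM
    exact (lineDeriv_indicator_of_mem_interior
      (interior_mono (element_subset_vertexMacro hs) hxs) v).symm
  · intro x hx
    have : indicator (vertexMacro K q) u =ᶠ[nhds x] fun _ => 0 := by
      filter_upwards [(isClosed_vertexMacro h).isOpen_compl.mem_nhds hx] with y hy
        using indicator_of_notMem hy _
    rw [this.lineDeriv_eq]
    simp [_root_.lineDeriv]

/-- Integration by parts on the macro-element. -/
theorem PiecewiseC1.integral_mul_lineDeriv (h : IsInteriorVertex K q) (hp : PiecewiseC1 K q p)
    (hu : PiecewiseC1 K q u) (h0 : ∀ x ∈ frontier (vertexMacro K q), u x = 0) (v : E3) :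
    ∫ x in vertexMacro K q, p x * _root_.lineDeriv ℝ u x v =
      - ∫ x in vertexMacro K q, _root_.lineDeriv ℝ p x v * u x := by
  have h1 := (hp.mul hu).integral_lineDeriv_eq_zero h (fun x hx => by simp [h0 x hx]) v
  have h2 : ∫ x in vertexMacro K q, _root_.lineDeriv ℝ (fun y => p y * u y) x v =
      ∫ x in vertexMacro K q,
        (_root_.lineDeriv ℝ p x v * u x + p x * _root_.lineDeriv ℝ u x v) := by
    refine setIntegral_congr_ae (isClosed_vertexMacro h).measurableSet ?_
    filter_upwards [ae_exists_mem_interior h.finite] with x hx hxM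
    obtain ⟨s, hs, hxs⟩ := hx hxM
    exact hp.lineDeriv_mul hu hs hxs v
  rw [h2, integral_add ((hp.lineDeriv v).mul hu.piecewiseCont |>.integrableOn h.finite)
    (hp.piecewiseCont.mul (hu.lineDeriv v) |>.integrableOn h.finite)] at h1
  linarith

/-! ### Weak gradients of piecewise regular functions -/

theorem PiecewiseC1.hasL2Grad (h : IsInteriorVertex K q) (hu : PiecewiseC1 K q u)
    (h0 : ∀ x ∈ frontier (vertexMacro K q), u x = 0) :
    HasL2Grad (interior (vertexMacro K q)) u
      (fun i x => _root_.lineDeriv ℝ u x (axis i)) := by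
  obtain ⟨C, hC⟩ := hu.exists_lipschitzWith h h0
  set U := interior (vertexMacro K q) with hU
  have hUo : IsOpen U := isOpen_interior
  have hfin : IsFiniteMeasure (volume.restrict U) :=
    ⟨by
      rw [Measure.restrict_apply_univ]
      exact (measure_mono interior_subset).trans_lt (isCompact_vertexMacro h).measure_lt_top⟩
  intro i
  constructor
  · have h1 : MemLp (fun x => _root_.lineDeriv ℝ (indicator (vertexMacro K q) u) x (axis i)) 2
        (volume.restrict U) := (hC.memLp_lineDeriv (axis i)).mono_exponent le_top
    refine h1.ae_eq ?_
    filter_upwards [ae_restrict_mem hUo.measurableSet] with x hx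
    exact lineDeriv_indicator_of_mem_interior hx _
  · intro φ hφ hφc hφU
    obtain ⟨D, hD⟩ := ContDiff.lipschitzWith_of_hasCompactSupport hφc hφ (by simp)
    have h1 := LipschitzWith.integral_lineDeriv_mul_eq (μ := volume) hC hD hφc (axis i)
    have hφd : ∀ x v, _root_.lineDeriv ℝ φ x v = fderiv ℝ φ x v := fun x v =>
      ((hφ.differentiable (by simp)) x).lineDeriv_eq_fderiv
    simp only [hφd, map_neg, neg_mul, integral_neg] at h1
    have h2 : ∫ x in U, _root_.lineDeriv ℝ (indicator (vertexMacro K q) u) x (axis i) * φ x =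
        ∫ x, _root_.lineDeriv ℝ (indicator (vertexMacro K q) u) x (axis i) * φ x := by
      refine setIntegral_eq_integral_of_forall_compl_eq_zero fun x hx => ?_
      rw [image_eq_zero_of_notMem_tsupport fun h => hx (hφU h), mul_zero]
    have h3 : ∫ x in U, fderiv ℝ φ x (axis i) * indicator (vertexMacro K q) u x =
        ∫ x, fderiv ℝ φ x (axis i) * indicator (vertexMacro K q) u x := by
      refine setIntegral_eq_integral_of_forall_compl_eq_zero fun x hx => ?_
      have : fderiv ℝ φ x = 0 := by
        by_contra hne
        exact hx (hφU (support_fderiv_subset ℝ hne))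
      simp [this]
    have e1 : ∫ x in U, u x * fderiv ℝ φ x (axis i) =
        ∫ x in U, fderiv ℝ φ x (axis i) * indicator (vertexMacro K q) u x := by
      refine setIntegral_congr_fun hUo.measurableSet fun x hx => ?_
      simp only [indicator_of_mem (interior_subset hx), mul_comm]
    have e2 : ∫ x in U, _root_.lineDeriv ℝ u x (axis i) * φ x =
        ∫ x in U, _root_.lineDeriv ℝ (indicator (vertexMacro K q) u) x (axis i) * φ x := by
      refine setIntegral_congr_fun hUo.measurableSet fun x hx => ?_
      simp only [lineDeriv_indicator_of_mem_interior hx]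
    rw [e1, e2]
    linarith

theorem PiecewiseC1.memH10C0 (h : IsInteriorVertex K q) (hu : PiecewiseC1 K q u)
    (h0 : ∀ x ∈ frontier (vertexMacro K q), u x = 0) : MemH10C0 (vertexMacro K q) u := by
  obtain ⟨C, hC⟩ := hu.exists_lipschitzWith h h0
  refine ⟨hC.continuous.continuousOn.congr fun x hx => (indicator_of_mem hx _).symm,
    ⟨?_, _, hu.hasL2Grad h h0⟩, h0⟩
  have h1 : MemLp (indicator (vertexMacro K q) u) 2
      (volume.restrict (interior (vertexMacro K q))) :=
    hC.continuous.memLp_of_hasCompactSupport (hasCompactSupport_indicator_vertexMacro h)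
  refine h1.ae_eq ?_
  filter_upwards [ae_restrict_mem isOpen_interior.measurableSet] with x hx
  exact indicator_of_mem (interior_subset hx) _

/-- Square integrable weak gradients are unique. -/
theorem HasL2Grad.ae_eq {U : Set E3} (hU : IsOpen U)
    {g₁ g₂ : Fin 3 → E3 → ℝ} (h₁ : HasL2Grad U u g₁) (h₂ : HasL2Grad U u g₂) (i : Fin 3) :
    ∀ᵐ x, x ∈ U → g₁ i x = g₂ i x := by
  have hloc : ∀ g : E3 → ℝ, MemLp g 2 (volume.restrict U) → LocallyIntegrableOn g U := by
    intro g hg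
    refine locallyIntegrableOn_of_locallyIntegrable_restrict ?_
    exact hg.locallyIntegrable (by norm_num)
  have key := hU.ae_eq_zero_of_integral_contDiff_smul_eq_zero (μ := volume)
    ((hloc _ (h₁ i).1).sub (hloc _ (h₂ i).1)) ?_
  · filter_upwards [key] with x hx hxU
    simpa [sub_eq_zero] using hx hxU
  · intro φ hφ hφc hφU
    have hint : ∀ g : E3 → ℝ, MemLp g 2 (volume.restrict U) →
        Integrable (fun x => g x * φ x) (volume.restrict U) := fun g hg =>
      hg.integrable_mul (hφ.continuous.memLp_of_hasCompactSupport (p := 2) hφc)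
    have e := (h₁ i).2 φ hφ hφc hφU
    rw [(h₂ i).2 φ hφ hφc hφU, neg_inj] at e
    rw [← setIntegral_eq_integral_of_forall_compl_eq_zero (s := U)]
    · have : ∀ x, φ x • (g₁ i - g₂ i) x = g₁ i x * φ x - g₂ i x * φ x := fun x => by
        simp; ring
      simp only [this]
      rw [integral_sub (hint _ (h₁ i).1) (hint _ (h₂ i).1), e, sub_self]
    · intro x hx
      rw [image_eq_zero_of_notMem_tsupport fun h => hx (hφU h), zero_smul]

/-- The divergence form on the macro-element, after integration by parts. -/
theorem integral_mul_div_eq (h : IsInteriorVertex K q) (hp : PiecewiseC1 K q p)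
    {w : Fin 3 → E3 → ℝ} (hw : ∀ j, PiecewiseC1 K q (w j))
    (h0 : ∀ j, ∀ x ∈ frontier (vertexMacro K q), w j x = 0) {g : Fin 3 → Fin 3 → E3 → ℝ}
    (hg : ∀ j, HasL2Grad (interior (vertexMacro K q)) (w j) (g j)) :
    ∫ x in vertexMacro K q, p x * ∑ i, g i i x =
      - ∑ i, ∫ x in vertexMacro K q, lineDeriv ℝ p x (axis i) * w i x := by
  have h1 : ∫ x in vertexMacro K q, p x * ∑ i, g i i x =
      ∫ x in vertexMacro K q, ∑ i, p x * lineDeriv ℝ (w i) x (axis i) := by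
    refine setIntegral_congr_ae (isClosed_vertexMacro h).measurableSet ?_
    have hae : ∀ᵐ x : E3, ∀ i, x ∈ interior (vertexMacro K q) →
        g i i x = lineDeriv ℝ (w i) x (axis i) := by
      rw [ae_all_iff]
      exact fun i => HasL2Grad.ae_eq isOpen_interior (hg i) ((hw i).hasL2Grad h (h0 i)) i
    filter_upwards [ae_exists_mem_interior h.finite, hae] with x hx hx' hxM
    obtain ⟨s, hs, hxs⟩ := hx hxM
    rw [Finset.mul_sum]
    exact Finset.sum_congr rfl fun i _ => by
      rw [hx' i (interior_mono (element_subset_vertexMacro hs) hxs)]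
  rw [h1, integral_finsetSum _ fun i _ =>
    hp.piecewiseCont.mul ((hw i).lineDeriv _) |>.integrableOn h.finite, ← Finset.sum_neg_distrib]
  exact Finset.sum_congr rfl fun i _ => hp.integral_mul_lineDeriv h (hw i) (h0 i) _

end Piecewise

section Velocity

variable {K : SimplicialComplex ℝ E3} {q : E3} {u p : E3 → ℝ} {s : Finset E3}

theorem affineMap_eq_linear_add (f : E3 →ᵃ[ℝ] ℝ) (x y : E3) :
    f x = f y + f.linear (x - y) := by
  have := f.map_vadd y (x - y)
  simpa [add_comm] using this

theorem affineMap_contDiff (f : E3 →ᵃ[ℝ] ℝ) : ContDiff ℝ 1 f := by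
  have : (f : E3 → ℝ) = fun x => LinearMap.toContinuousLinearMap f.linear x + f 0 := by
    rw [f.decomp]; ext; simp
  rw [this]
  fun_prop

theorem affineMap_continuous (f : E3 →ᵃ[ℝ] ℝ) : Continuous f := (affineMap_contDiff f).continuous

theorem lineDeriv_affineMap (f : E3 →ᵃ[ℝ] ℝ) (x v : E3) : lineDeriv ℝ f x v = f.linear v := by
  have : (fun t : ℝ => f (x + t • v)) = fun t => t * f.linear v + f x := by
    ext t
    have := affineMap_eq_linear_add f (x + t • v) x
    rw [this]; simp [add_comm]
  rw [lineDeriv, this]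
  simp

theorem linear_eq_sum_axis (f : E3 →ₗ[ℝ] ℝ) (v : E3) : f v = ∑ i, v i * f (axis i) := by
  conv_lhs => rw [show v = ∑ i, v i • axis i from by
    ext j; simp [axis, Fin.sum_univ_three]; fin_cases j <;> simp]
  simp

theorem lineDeriv_of_eqOn {f : E3 →ᵃ[ℝ] ℝ} (h : EqOn p f (convexHull ℝ (s : Set E3))) {x : E3}
    (hx : x ∈ interior (convexHull ℝ (s : Set E3))) (v : E3) :
    lineDeriv ℝ p x v = f.linear v := by
  rw [(eventuallyEq_of_eqOn_interior h hx).lineDeriv_eq, lineDeriv_affineMap]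

theorem IsP1On.exists_contDiff (h : IsP1On s u) :
    ∃ f : E3 → ℝ, ContDiff ℝ 1 f ∧ EqOn u f (convexHull ℝ (s : Set E3)) := by
  obtain ⟨f, hf⟩ := h
  exact ⟨f, affineMap_contDiff f, hf⟩

theorem IsP1bOn.exists_contDiff (h : IsP1bOn s u) :
    ∃ f : E3 → ℝ, ContDiff ℝ 1 f ∧ EqOn u f (convexHull ℝ (s : Set E3)) := by
  obtain ⟨f, β, lam, -, hf⟩ := h
  exact ⟨fun x => f x + β * ∏ v ∈ s, lam v x, (affineMap_contDiff f).add
    (contDiff_const.mul (contDiff_prod fun v _ => affineMap_contDiff (lam v))), hf⟩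

theorem IsP1On.isP1bOn (hs : s ∈ meshElements K) (h : IsP1On s u) : IsP1bOn s u := by
  obtain ⟨f, hf⟩ := h
  exact ⟨f, 0, bary hs, isBarycentric_bary hs, fun x hx => by rw [hf x hx]; ring⟩

theorem MemPressure.isP1On (hp : MemPressure K (vertexMacro K q) p) (hs : s ∈ vertexStar K q) :
    IsP1On s p := hp.2 s hs.1 (element_subset_vertexMacro hs)

theorem MemPressure.piecewiseC1 (hp : MemPressure K (vertexMacro K q) p) : PiecewiseC1 K q p :=
  fun _ hs => (hp.isP1On hs).exists_contDiff

theorem MemVelocity.piecewiseC1 {w : Fin 3 → E3 → ℝ}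
    (hw : MemVelocity K (vertexMacro K q) w) (j : Fin 3) : PiecewiseC1 K q (w j) := by
  intro s hs
  obtain ⟨h0, h1, h2⟩ := hw.2 s hs.1 (element_subset_vertexMacro hs)
  fin_cases j
  · exact h0.exists_contDiff
  · exact h1.exists_contDiff
  · exact h2.exists_contDiff

/-- Being continuous on each element is enough to be continuous on the macro-element. -/
theorem continuousOn_vertexMacro (h : IsInteriorVertex K q)
    (hu : ∀ s ∈ vertexStar K q, ContinuousOn u (convexHull ℝ (s : Set E3))) :
    ContinuousOn u (vertexMacro K q) := by
  have : Finite (vertexStar K q) := h.finite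
  rw [vertexMacro_eq, region, biUnion_eq_iUnion]
  exact (locallyFinite_of_finite _).continuousOn_iUnion (fun s => isClosed_element _)
    fun s => hu s s.2

/-! ### The velocity fields: hat functions and bubbles -/

open Classical in
/-- The hat function of the vertex `q`: on each element around `q` it is the barycentric coordinate
with respect to `q`. -/
noncomputable def hat (K : SimplicialComplex ℝ E3) (q x : E3) : ℝ :=
  if h : ∃ s, ∃ _ : s ∈ vertexStar K q, x ∈ convexHull ℝ (s : Set E3) then
    bary h.choose_spec.choose.1 q x else 0

theorem hat_eq (hs : s ∈ vertexStar K q) {x : E3} (hx : x ∈ convexHull ℝ (s : Set E3)) :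
    hat K q x = bary hs.1 q x := by
  have h : ∃ s, ∃ _ : s ∈ vertexStar K q, x ∈ convexHull ℝ (s : Set E3) := ⟨s, hs, hx⟩
  rw [hat, dif_pos h]
  exact bary_eq_of_mem _ hs.1 h.choose_spec.choose.2 hs.2 h.choose_spec.choose_spec hx

theorem hat_nonneg {x : E3} (hx : x ∈ vertexMacro K q) : 0 ≤ hat K q x := by
  obtain ⟨s, hs, hxs⟩ := mem_vertexMacro.1 hx
  rw [hat_eq hs hxs]
  rw [convexHull_eq_bary hs.1] at hxs
  exact hxs q hs.2

theorem isP1On_hat (hs : s ∈ vertexStar K q) : IsP1On s (hat K q) :=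
  ⟨bary hs.1 q, fun _ hx => hat_eq hs hx⟩

theorem piecewiseC1_hat : PiecewiseC1 K q (hat K q) := fun _ hs => (isP1On_hat hs).exists_contDiff

theorem continuousOn_hat (h : IsInteriorVertex K q) :
    ContinuousOn (hat K q) (vertexMacro K q) :=
  continuousOn_vertexMacro h fun _ hs => (affineMap_continuous (bary hs.1 q)).continuousOn.congr
    fun _ hx => hat_eq hs hx

/-- The macro-element is a neighbourhood of each point at which the hat function is positive. Such
a point and its neighbours are contracted into a small ball around `q`, where the hat function is
continuous; barycentric coordinates with respect to the other vertices scale by the factor of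
contraction. -/
theorem mem_interior_of_hat_pos (h : IsInteriorVertex K q) {x : E3} (hx : x ∈ vertexMacro K q)
    (hpos : 0 < hat K q x) : x ∈ interior (vertexMacro K q) := by
  have hq : q ∈ interior (vertexMacro K q) := mem_interior_iff_mem_nhds.2 h.mem_nhds
  have hc : Filter.Tendsto (fun t : ℝ => q + t • (x - q)) (nhdsWithin 0 (Ioi 0)) (nhds q) :=
    tendsto_add_smul _ _
  obtain ⟨t, ⟨ht, ht1⟩, ht0⟩ := (((hc.eventually (isOpen_interior.mem_nhds hq)).and
    (nhdsWithin_le_nhds (Iio_mem_nhds (show (0 : ℝ) < 1 by norm_num)))).and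
    self_mem_nhdsWithin).exists
  have ht0 : 0 < t := ht0
  have ht1 : t < 1 := ht1
  obtain ⟨s, hs, hxs⟩ := mem_vertexMacro.1 hx
  have hy : 1 - t < hat K q (q + t • (x - q)) := by
    rw [hat_eq hs (homothety_mem hs hxs ht0.le ht1.le), affine_homothety, bary_self hs.1 hs.2]
    rw [hat_eq hs hxs] at hpos
    nlinarith
  have hc1 : ContinuousAt (hat K q) (q + t • (x - q)) :=
    (continuousOn_hat h).continuousAt (mem_interior_iff_mem_nhds.1 ht)
  have hc2 : ContinuousAt (fun y : E3 => q + t • (y - q)) x := by fun_prop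
  have e1 := hc2.eventually (hc1.eventually (lt_mem_nhds hy))
  have e2 := hc2.eventually (mem_interior_iff_mem_nhds.1 ht)
  rw [mem_interior_iff_mem_nhds]
  filter_upwards [e1, e2] with y hy1 hy2
  obtain ⟨r, hr, hyr⟩ := mem_vertexMacro.1 hy2
  rw [hat_eq hr hyr, affine_homothety, bary_self hr.1 hr.2] at hy1
  refine mem_vertexMacro.2 ⟨r, hr, ?_⟩
  rw [convexHull_eq_bary hr.1] at hyr ⊢
  intro v hv
  rcases eq_or_ne q v with rfl | hvq
  · nlinarith
  · have := hyr v hv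
    rw [affine_homothety, bary_ne hr.1 hr.2 hvq] at this
    simp only [sub_zero, zero_add] at this
    exact nonneg_of_mul_nonneg_right this ht0

theorem hat_eq_zero_of_mem_frontier (h : IsInteriorVertex K q) {x : E3}
    (hx : x ∈ frontier (vertexMacro K q)) : hat K q x = 0 := by
  have hxM : x ∈ vertexMacro K q := (isClosed_vertexMacro h).frontier_subset hx
  by_contra hne
  exact hx.2 (mem_interior_of_hat_pos h hxM (lt_of_le_of_ne (hat_nonneg hxM) (Ne.symm hne)))

theorem integral_hat_pos (h : IsInteriorVertex K q) : 0 < ∫ x in vertexMacro K q, hat K q x := by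
  obtain ⟨s, hs, -⟩ := mem_vertexMacro.1 (mem_of_mem_nhds h.mem_nhds)
  rw [setIntegral_pos_iff_support_of_nonneg_ae]
  · refine (isOpen_interior.measure_pos volume (interior_convexHull_nonempty hs.1)).trans_le
      (measure_mono fun x hx => ⟨?_, element_subset_vertexMacro hs (interior_subset hx)⟩)
    rw [Function.mem_support, hat_eq hs (interior_subset hx)]
    rw [interior_convexHull_eq_bary hs.1] at hx
    exact (hx q hs.2).ne'
  · filter_upwards [ae_restrict_mem (isClosed_vertexMacro h).measurableSet] with x hx
    exact hat_nonneg hx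
  · exact piecewiseC1_hat.piecewiseCont.integrableOn h.finite

/-- As the vertices other than `q` lie on the boundary, the continuous piecewise affine functions
that vanish there are the multiples of the hat function. -/
theorem eq_mul_hat (hu : ∀ s ∈ vertexStar K q, IsP1On s u)
    (h0 : ∀ x ∈ frontier (vertexMacro K q), u x = 0) {x : E3} (hx : x ∈ vertexMacro K q) :
    u x = u q * hat K q x := by
  obtain ⟨s, hs, hxs⟩ := mem_vertexMacro.1 hx
  obtain ⟨f, hf⟩ := hu s hs
  have : f = u q • bary hs.1 q := by
    refine affineMap_ext_of_element hs.1 fun v hv => ?_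
    rw [← hf v (subset_convexHull ℝ _ hv)]
    rcases eq_or_ne v q with rfl | hvq
    · simp [bary_self hs.1 hv]
    · simp [bary_ne hs.1 hv hvq, h0 v (vertex_mem_frontier hs hv hvq)]
  rw [hf x hxs, hat_eq hs hxs, this]
  simp

open Classical in
/-- The bubble function of an element, extended by zero. -/
noncomputable def bubble (hs : s ∈ meshElements K) (x : E3) : ℝ :=
  if x ∈ interior (convexHull ℝ (s : Set E3)) then ∏ v ∈ s, bary hs v x else 0

theorem bubble_eq (hs : s ∈ meshElements K) {x : E3} (hx : x ∈ convexHull ℝ (s : Set E3)) :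
    bubble hs x = ∏ v ∈ s, bary hs v x := by
  rw [bubble]
  split_ifs with hi
  · rfl
  · rw [interior_convexHull_eq_bary hs] at hi
    rw [convexHull_eq_bary hs] at hx
    simp only [mem_ofPred_eq, not_forall, not_lt] at hi
    obtain ⟨v, hv, hle⟩ := hi
    exact (Finset.prod_eq_zero hv (le_antisymm hle (hx v hv))).symm

theorem bubble_pos (hs : s ∈ meshElements K) {x : E3}
    (hx : x ∈ interior (convexHull ℝ (s : Set E3))) : 0 < bubble hs x := by
  rw [bubble, if_pos hx]
  rw [interior_convexHull_eq_bary hs] at hx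
  exact Finset.prod_pos hx

theorem bubble_nonneg (hs : s ∈ meshElements K) (x : E3) : 0 ≤ bubble hs x := by
  by_cases hx : x ∈ interior (convexHull ℝ (s : Set E3))
  · exact (bubble_pos hs hx).le
  · rw [bubble, if_neg hx]

theorem bubble_eq_zero_of_ne {t : Finset E3} (hs : s ∈ meshElements K) (ht : t ∈ meshElements K)
    (hne : t ≠ s) {x : E3} (hx : x ∈ convexHull ℝ (t : Set E3)) : bubble hs x = 0 := by
  rw [bubble, if_neg fun hi => hne (subset_of_mem_interior hs ht hi hx).symm]

theorem isP1bOn_bubble (hs : s ∈ meshElements K) {t : Finset E3} (ht : t ∈ meshElements K) :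
    IsP1bOn t (bubble hs) := by
  rcases eq_or_ne t s with rfl | hne
  · exact ⟨0, 1, bary hs, isBarycentric_bary hs, fun x hx => by simp [bubble_eq hs hx]⟩
  · exact IsP1On.isP1bOn ht ⟨0, fun x hx => by simp [bubble_eq_zero_of_ne hs ht hne hx]⟩

theorem bubble_eq_zero_of_mem_frontier (hs : s ∈ vertexStar K q) {x : E3}
    (hx : x ∈ frontier (vertexMacro K q)) : bubble hs.1 x = 0 := by
  rw [bubble, if_neg fun hi => hx.2 (interior_mono (element_subset_vertexMacro hs) hi)]

/-! ### The kernel of the divergence form -/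

/-- A field with a single nonzero component belongs to the velocity space if this component does. -/
theorem memVelocity_single (h : IsInteriorVertex K q) (i : Fin 3) (hu : PiecewiseC1 K q u)
    (h0 : ∀ x ∈ frontier (vertexMacro K q), u x = 0)
    (hP : ∀ s ∈ vertexStar K q, IsP1On s u ∨ i = 2 ∧ IsP1bOn s u) :
    MemVelocity K (vertexMacro K q) (Pi.single i u) := by
  have hz : ∀ t, IsP1On t (0 : E3 → ℝ) := fun t => ⟨0, fun x _ => by simp⟩
  have hzC : PiecewiseC1 K q 0 := fun s _ => (hz s).exists_contDiff
  refine ⟨fun j => ?_, fun s hs hsub => ?_⟩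
  · rcases eq_or_ne j i with rfl | hji
    · rw [Pi.single_eq_same]; exact hu.memH10C0 h h0
    · rw [Pi.single_eq_of_ne hji]
      exact hzC.memH10C0 h fun _ _ => rfl
  · have := hP s (mem_vertexStar_of_subset hs hsub)
    fin_cases i <;> simp [hz, (hz s).isP1bOn hs] at this ⊢
    · exact this
    · exact this
    · exact this.elim (fun h => h.isP1bOn hs) id

theorem MemKernel.integral_lineDeriv_mul (h : IsInteriorVertex K q)
    (hp : MemKernel K (vertexMacro K q) p) (i : Fin 3) (hu : PiecewiseC1 K q u)
    (h0 : ∀ x ∈ frontier (vertexMacro K q), u x = 0)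
    (hP : ∀ s ∈ vertexStar K q, IsP1On s u ∨ i = 2 ∧ IsP1bOn s u) :
    ∫ x in vertexMacro K q, lineDeriv ℝ p x (axis i) * u x = 0 := by
  have hw := memVelocity_single h i hu h0 hP
  have hf := fun j x hx => (hw.1 j).2.2 x hx
  have hg := fun j => (hw.piecewiseC1 j).hasL2Grad h (hf j)
  have h1 := hp.2 _ hw _ hg
  rw [integral_mul_div_eq h hp.1.piecewiseC1 hw.piecewiseC1 hf hg, neg_eq_zero,
    Finset.sum_eq_single i] at h1
  · simpa using h1
  · intro j _ hji
    simp [Pi.single_eq_of_ne hji]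
  · simp

/-- Testing with the bubble of an element shows that a pressure of the kernel does not depend on
the vertical coordinate there. -/
theorem MemKernel.linear_axis_two (h : IsInteriorVertex K q)
    (hp : MemKernel K (vertexMacro K q) p) (hs : s ∈ vertexStar K q) {f : E3 →ᵃ[ℝ] ℝ}
    (hf : EqOn p f (convexHull ℝ (s : Set E3))) : f.linear (axis 2) = 0 := by
  have hC : PiecewiseC1 K q (bubble hs.1) := fun t ht => (isP1bOn_bubble hs.1 ht.1).exists_contDiff
  have h1 := hp.integral_lineDeriv_mul h 2 hC
    (fun x hx => bubble_eq_zero_of_mem_frontier hs hx)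
    (fun t ht => Or.inr ⟨rfl, isP1bOn_bubble hs.1 ht.1⟩)
  have h2 : ∫ x in vertexMacro K q, lineDeriv ℝ p x (axis 2) * bubble hs.1 x =
      ∫ x in vertexMacro K q, f.linear (axis 2) * bubble hs.1 x := by
    refine integral_congr_ae (Filter.Eventually.of_forall fun x => ?_)
    by_cases hx : x ∈ interior (convexHull ℝ (s : Set E3))
    · simp only [lineDeriv_of_eqOn hf hx]
    · simp [bubble, hx]
  rw [h2, integral_const_mul] at h1
  refine (mul_eq_zero.1 h1).resolve_right (ne_of_gt ?_)
  rw [setIntegral_pos_iff_support_of_nonneg_ae]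
  · refine (isOpen_interior.measure_pos volume (interior_convexHull_nonempty hs.1)).trans_le
      (measure_mono fun x hx => ⟨(bubble_pos hs.1 hx).ne', ?_⟩)
    exact element_subset_vertexMacro hs (interior_subset hx)
  · exact Filter.Eventually.of_forall fun x => bubble_nonneg hs.1 x
  · exact hC.piecewiseCont.integrableOn h.finite

/-- Testing with the hat function shows that the kernel contains no affine function except the
constants. -/
theorem MemKernel.const_of_affine (h : IsInteriorVertex K q)
    (hp : MemKernel K (vertexMacro K q) p) {f : E3 →ᵃ[ℝ] ℝ} (hf : EqOn p f (vertexMacro K q)) :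
    ∃ c, ∀ x ∈ vertexMacro K q, p x = c := by
  have key : ∀ i, f.linear (axis i) = 0 := by
    intro i
    have h1 := hp.integral_lineDeriv_mul h i piecewiseC1_hat
      (fun x hx => hat_eq_zero_of_mem_frontier h hx) (fun t ht => Or.inl (isP1On_hat ht))
    have h2 : ∫ x in vertexMacro K q, lineDeriv ℝ p x (axis i) * hat K q x =
        ∫ x in vertexMacro K q, f.linear (axis i) * hat K q x := by
      refine setIntegral_congr_ae (isClosed_vertexMacro h).measurableSet ?_
      filter_upwards [ae_exists_mem_interior h.finite] with x hx hxM
      obtain ⟨s, hs, hxs⟩ := hx hxM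
      rw [lineDeriv_of_eqOn (hf.mono (element_subset_vertexMacro hs)) hxs]
    rw [h2, integral_const_mul] at h1
    exact (mul_eq_zero.1 h1).resolve_right (integral_hat_pos h).ne'
  refine ⟨f q, fun x hx => ?_⟩
  rw [hf hx, affineMap_eq_linear_add f x q, linear_eq_sum_axis]
  simp [key]

/-- A pressure that does not depend on the vertical coordinate belongs to the kernel as soon as it
passes the test with horizontal hat functions. -/
theorem memKernel_of_integral_eq_zero (h : IsInteriorVertex K q)
    (hp : MemPressure K (vertexMacro K q) p)
    (hz : ∀ s ∈ vertexStar K q, ∀ x ∈ interior (convexHull ℝ (s : Set E3)),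
      lineDeriv ℝ p x (axis 2) = 0)
    (h0 : ∫ x in vertexMacro K q, lineDeriv ℝ p x (axis 0) * hat K q x = 0)
    (h1 : ∫ x in vertexMacro K q, lineDeriv ℝ p x (axis 1) * hat K q x = 0) :
    MemKernel K (vertexMacro K q) p := by
  refine ⟨hp, fun w hw g hg => ?_⟩
  have hf := fun j x hx => (hw.1 j).2.2 x hx
  rw [integral_mul_div_eq h hp.piecewiseC1 hw.piecewiseC1 hf hg, Fin.sum_univ_three]
  have hhat : ∀ i, (∀ s ∈ vertexStar K q, IsP1On s (w i)) →
      ∫ x in vertexMacro K q, lineDeriv ℝ p x (axis i) * hat K q x = 0 →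
      ∫ x in vertexMacro K q, lineDeriv ℝ p x (axis i) * w i x = 0 := by
    intro i hi hzero
    have : ∫ x in vertexMacro K q, lineDeriv ℝ p x (axis i) * w i x =
        ∫ x in vertexMacro K q, w i q * (lineDeriv ℝ p x (axis i) * hat K q x) := by
      refine setIntegral_congr_fun (isClosed_vertexMacro h).measurableSet fun x hx => ?_
      simp only [eq_mul_hat hi (hf i) hx]
      ring
    rw [this, integral_const_mul, hzero, mul_zero]
  have e2 : ∫ x in vertexMacro K q, lineDeriv ℝ p x (axis 2) * w 2 x = 0 := by
    rw [← integral_zero E3 ℝ (μ := volume.restrict (vertexMacro K q))]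
    refine setIntegral_congr_ae (isClosed_vertexMacro h).measurableSet ?_
    filter_upwards [ae_exists_mem_interior h.finite] with x hx hxM
    obtain ⟨s, hs, hxs⟩ := hx hxM
    rw [hz s hs x hxs, zero_mul]
  rw [hhat 0 (fun s hs => (hw.2 s hs.1 (element_subset_vertexMacro hs)).1) h0,
    hhat 1 (fun s hs => (hw.2 s hs.1 (element_subset_vertexMacro hs)).2.1) h1, e2]
  simp

end Velocity

/-! ### Horizontal projection and vertical semi-planes -/

/-- The projection of the space onto its first two coordinates, with values in the complex plane. -/
noncomputable def horiz : E3 →L[ℝ] ℂ :=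
  LinearMap.toContinuousLinearMap
    { toFun := fun x => ⟨x 0, x 1⟩
      map_add' := fun x y => by apply Complex.ext <;> simp
      map_smul' := fun a x => by apply Complex.ext <;> simp }

/-- The embedding of the complex plane into the space as the horizontal plane through `0`. -/
noncomputable def lift : ℂ →L[ℝ] E3 :=
  LinearMap.toContinuousLinearMap
    { toFun := fun w => w.re • axis 0 + w.im • axis 1
      map_add' := fun x y => by simp [add_smul]; abel
      map_smul' := fun a x => by simp [smul_smul] }

theorem horiz_apply (x : E3) : horiz x = ⟨x 0, x 1⟩ := rfl

theorem lift_apply (w : ℂ) : lift w = w.re • axis 0 + w.im • axis 1 := rfl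

@[simp] theorem lift_apply_zero (w : ℂ) : lift w 0 = w.re := by simp [lift_apply, axis]

@[simp] theorem lift_apply_one (w : ℂ) : lift w 1 = w.im := by simp [lift_apply, axis]

@[simp] theorem lift_apply_two (w : ℂ) : lift w 2 = 0 := by simp [lift_apply, axis]

@[simp] theorem horiz_lift (w : ℂ) : horiz (lift w) = w := by
  apply Complex.ext <;> simp [horiz_apply]

@[simp] theorem horiz_axis_two : horiz (axis 2) = 0 := by
  apply Complex.ext <;> simp [horiz_apply, axis]

theorem lift_horiz_add (x : E3) : lift (horiz x) + x 2 • axis 2 = x := by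
  ext i
  fin_cases i <;> simp [horiz_apply, axis]

theorem norm_lift (w : ℂ) : ‖lift w‖ = ‖w‖ := by
  rw [EuclideanSpace.norm_eq, Complex.norm_eq_sqrt_sq_add_sq]
  simp [Fin.sum_univ_three]

theorem norm_lift_horiz_le (x : E3) : ‖lift (horiz x)‖ ≤ ‖x‖ := by
  rw [EuclideanSpace.norm_eq, EuclideanSpace.norm_eq]
  refine Real.sqrt_le_sqrt ?_
  simp [Fin.sum_univ_three, horiz_apply]
  positivity

/-- The closed vertical semi-plane bounded by the vertical line through `q`, whose projection is
the ray spanned by the complex number `w`. -/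
def semiplane (q : E3) (w : ℂ) : Set E3 := {x | ∃ a : ℝ, 0 ≤ a ∧ horiz (x - q) = a • w}

theorem semiplane_eq (q : E3) (w : ℂ) : semiplane q w = verticalSemiplane q (lift w) := by
  ext x
  constructor
  · rintro ⟨a, ha, h⟩
    refine ⟨a, (x - q) 2, ha, ?_⟩
    have := lift_horiz_add (x - q)
    rw [h, map_smul] at this
    rw [add_assoc, this]; abel
  · rintro ⟨a, t, ha, h⟩
    refine ⟨a, ha, ?_⟩
    rw [h, add_assoc, add_sub_cancel_left, map_add, map_smul, map_smul]
    simp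

theorem isHorizontal_lift {w : ℂ} (hw : w ≠ 0) : IsHorizontal (lift w) :=
  ⟨fun h => hw (by rw [← horiz_lift w, h, map_zero]), lift_apply_two w⟩

theorem IsHorizontal.lift_horiz {d : E3} (hd : IsHorizontal d) : lift (horiz d) = d := by
  have := lift_horiz_add d
  simpa [hd.2] using this

theorem IsHorizontal.horiz_ne_zero {d : E3} (hd : IsHorizontal d) : horiz d ≠ 0 :=
  fun h => hd.1 (by rw [← hd.lift_horiz, h, map_zero])

theorem mem_semiplaneFamily_iff {q : E3} {P : Set E3} :
    P ∈ semiplaneFamily q ↔ ∃ w : ℂ, w ≠ 0 ∧ P = semiplane q w := by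
  constructor
  · rintro ⟨d, hd, rfl⟩
    exact ⟨horiz d, hd.horiz_ne_zero, by rw [semiplane_eq, hd.lift_horiz]⟩
  · rintro ⟨w, hw, rfl⟩
    exact ⟨lift w, isHorizontal_lift hw, semiplane_eq q w⟩

/-- Two semi-planes of the family coincide if and only if their rays do. -/
theorem semiplane_eq_iff {q : E3} {v w : ℂ} (hv : v ≠ 0) :
    semiplane q v = semiplane q w ↔ ∃ a : ℝ, 0 < a ∧ v = a • w := by
  constructor
  · intro h
    have h1 : q + lift v ∈ semiplane q v := ⟨1, zero_le_one, by simp⟩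
    rw [h] at h1
    obtain ⟨a, ha, h2⟩ := h1
    simp only [add_sub_cancel_left, horiz_lift] at h2
    refine ⟨a, lt_of_le_of_ne ha ?_, h2⟩
    rintro rfl
    exact hv (by simp [h2])
  · rintro ⟨a, ha, rfl⟩
    ext x
    constructor
    · rintro ⟨b, hb, h⟩
      exact ⟨b * a, by positivity, by rw [h, smul_smul]⟩
    · rintro ⟨b, hb, h⟩
      exact ⟨b / a, by positivity, by rw [h, smul_smul, div_mul_cancel₀ _ ha.ne']⟩

theorem axis_mem_semiplane {q : E3} (w : ℂ) {x : E3} (hx : horiz (x - q) = 0) :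
    x ∈ semiplane q w := ⟨0, le_rfl, by simp [hx]⟩

/-- The semi-plane over the ray of `w` meets no interior of an element around `q`: inside the
macro-element it consists of points of the two-dimensional skeleton of the mesh. -/
def InSkeleton (K : SimplicialComplex ℝ E3) (q : E3) (w : ℂ) : Prop :=
  ∀ s ∈ vertexStar K q, Disjoint (interior (convexHull ℝ (s : Set E3))) (semiplane q w)

/-! ### Locally linear functions on the plane -/

/-- The determinant of two vectors of the plane. -/
def planeDet (u v : ℂ) : ℝ := u.re * v.im - u.im * v.re

/-- The coordinates with respect to two linearly independent vectors of the plane. -/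
theorem exists_coordinates {u v : ℂ} (h : planeDet u v ≠ 0) :
    ∃ A B : ℂ →ₗ[ℝ] ℝ, A u = 1 ∧ A v = 0 ∧ B u = 0 ∧ B v = 1 ∧ ∀ w, w = A w • u + B w • v := by
  refine ⟨{ toFun := fun w => planeDet w v / planeDet u v
            map_add' := fun x y => by simp only [planeDet, Complex.add_re, Complex.add_im]; ring
            map_smul' := fun a x => by
              simp only [planeDet, Complex.real_smul, Complex.re_ofReal_mul, Complex.im_ofReal_mul,
                RingHom.id_apply, smul_eq_mul]; ring },
          { toFun := fun w => planeDet u w / planeDet u v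
            map_add' := fun x y => by simp only [planeDet, Complex.add_re, Complex.add_im]; ring
            map_smul' := fun a x => by
              simp only [planeDet, Complex.real_smul, Complex.re_ofReal_mul, Complex.im_ofReal_mul,
                RingHom.id_apply, smul_eq_mul]; ring }, ?_, ?_, ?_, ?_, ?_⟩
  · simp [h]
  · simp [planeDet, mul_comm]
  · simp [planeDet, mul_comm]
  · simp [h]
  · intro w
    apply Complex.ext
    · simp only [LinearMap.coe_mk, AddHom.coe_mk, Complex.add_re, Complex.real_smul,
        Complex.re_ofReal_mul]
      field_simp
      simp only [planeDet]; ring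
    · simp only [LinearMap.coe_mk, AddHom.coe_mk, Complex.add_im, Complex.real_smul,
        Complex.im_ofReal_mul]
      field_simp
      simp only [planeDet]; ring

theorem linearMap_ext_of_eventually {L L' : ℂ →ₗ[ℝ] ℝ} {w : ℂ}
    (h : ∀ᶠ v in nhds w, L v = L' v) : L = L' := by
  ext1 v
  · have hc : Filter.Tendsto (fun t : ℝ => w + t • v) (nhdsWithin 0 {0}ᶜ) (nhds w) := by
      refine Filter.Tendsto.mono_left ?_ nhdsWithin_le_nhds
      have : Continuous (fun t : ℝ => w + t • v) := by fun_prop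
      simpa using this.tendsto 0
    obtain ⟨t, ht, ht0⟩ := ((hc.eventually h).and self_mem_nhdsWithin).exists
    rw [map_add, map_add, h.self_of_nhds, map_smul, map_smul] at ht
    exact mul_left_cancel₀ (show t ≠ 0 from ht0) (by simpa using ht)

theorem exists_linearMap_of_isPreconnected {F : ℂ → ℝ} {U : Set ℂ} (hU : IsPreconnected U)
    (h : ∀ w ∈ U, ∃ L : ℂ →ₗ[ℝ] ℝ, ∀ᶠ v in nhds w, F v = L v) :
    ∃ L : ℂ →ₗ[ℝ] ℝ, ∀ w ∈ U, F w = L w := by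
  rcases U.eq_empty_or_nonempty with rfl | ⟨u, hu⟩
  · exact ⟨0, by simp⟩
  obtain ⟨L, hL⟩ := h u hu
  have h1 : IsOpen {w | ∀ᶠ v in nhds w, F v = L v} := isOpen_iff_eventually.2 fun w hw =>
    eventually_eventually_nhds.2 hw
  have h2 : IsOpen {w | ∃ L' : ℂ →ₗ[ℝ] ℝ, L' ≠ L ∧ ∀ᶠ v in nhds w, F v = L' v} := by
    rw [isOpen_iff_eventually]
    rintro w ⟨L', hL', hw⟩
    filter_upwards [eventually_eventually_nhds.2 hw] with v hv
    exact ⟨L', hL', hv⟩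
  have hsub := hU.subset_left_of_subset_union h1 h2 ?_ ?_ ⟨u, hu, hL⟩
  · exact ⟨L, fun w hw => (hsub hw).self_of_nhds⟩
  · rw [Set.disjoint_left]
    rintro w hw ⟨L', hL', hw'⟩
    refine hL' (linearMap_ext_of_eventually (w := w) ?_)
    filter_upwards [hw, hw'] with v hv hv'
    rw [← hv', hv]
  · intro w hw
    obtain ⟨L', hL'⟩ := h w hw
    by_cases heq : L' = L
    · exact Or.inl (heq ▸ hL')
    · exact Or.inr ⟨L', heq, hL'⟩

theorem mem_closure_inter_ball {r : ℝ} {w e : ℂ} {S : Set ℂ} (hw : w ∈ Metric.ball (0 : ℂ) r)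
    (h : ∀ η : ℝ, 0 < η → w + η • e ∈ S) : w ∈ closure (Metric.ball 0 r ∩ S) := by
  have hc : Filter.Tendsto (fun t : ℝ => w + t • e) (nhdsWithin 0 (Ioi 0)) (nhds w) :=
    tendsto_add_smul _ _
  refine mem_closure_of_tendsto hc ?_
  filter_upwards [hc.eventually (Metric.isOpen_ball.mem_nhds hw), self_mem_nhdsWithin] with t h1 h2
  exact ⟨h1, h t h2⟩

/-- A continuous function on a disc that is locally linear off two linearly independent rays is
linear: the two open half-planes that avoid one of the rays and the remaining open quadrant carry
linear functions, and these agree along the lines that separate them. -/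
theorem exists_linearMap_of_two_rays {F : ℂ → ℝ} {r : ℝ} (hr : 0 < r)
    (hF : ContinuousOn F (Metric.ball 0 r)) {d₁ d₂ : ℂ} (hd : planeDet d₁ d₂ ≠ 0)
    (h : ∀ w ∈ Metric.ball (0 : ℂ) r, w ≠ 0 → (∀ a : ℝ, 0 ≤ a → w ≠ a • d₁) →
      (∀ a : ℝ, 0 ≤ a → w ≠ a • d₂) → ∃ L : ℂ →ₗ[ℝ] ℝ, ∀ᶠ v in nhds w, F v = L v) :
    ∃ L : ℂ →ₗ[ℝ] ℝ, ∀ w ∈ Metric.ball (0 : ℂ) r, F w = L w := by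
  obtain ⟨A, B, hA1, hA2, hB1, hB2, hAB⟩ := exists_coordinates hd
  have hcont : ∀ L : ℂ →ₗ[ℝ] ℝ, ContinuousOn L (Metric.ball 0 r) := fun L =>
    (LinearMap.continuous_of_finiteDimensional L).continuousOn
  have key : ∀ S T : Set ℂ, Convex ℝ S →
      (∀ w ∈ S, (A w < 0 ∨ B w < 0 ∨ 0 < A w ∧ 0 < B w)) →
      (∃ e : ℂ, ∀ w ∈ T, ∀ η : ℝ, 0 < η → w + η • e ∈ S) → S ⊆ T →
      ∃ L : ℂ →ₗ[ℝ] ℝ, ∀ w ∈ Metric.ball (0 : ℂ) r ∩ T, F w = L w := by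
    intro S T hS hsub ⟨e, he⟩ hST
    obtain ⟨L, hL⟩ := exists_linearMap_of_isPreconnected (F := F)
      ((convex_ball (0 : ℂ) r).inter hS).isPreconnected (fun w hw => by
        have hw' := hsub w hw.2
        refine h w hw.1 ?_ ?_ ?_
        · rintro rfl; simp at hw'
        · rintro a ha rfl
          simp only [map_smul, hA1, hB1, smul_eq_mul, mul_one, mul_zero] at hw'
          rcases hw' with h | h | h <;> linarith
        · rintro a ha rfl
          simp only [map_smul, hA2, hB2, smul_eq_mul, mul_one, mul_zero] at hw'
          rcases hw' with h | h | h <;> linarith)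
    refine ⟨L, EqOn.of_subset_closure (s := Metric.ball 0 r ∩ S) hL
      (hF.mono inter_subset_left) ((hcont L).mono inter_subset_left)
      (inter_subset_inter_right _ hST) ?_⟩
    exact fun w hw => mem_closure_inter_ball hw.1 (he w hw.2)
  obtain ⟨L₁, h₁⟩ := key {w | A w < 0} {w | A w ≤ 0}
    ((convex_Iio (0 : ℝ)).linear_preimage A) (fun w hw => Or.inl hw)
    ⟨-d₁, fun w hw η hη => by
      have : A w ≤ 0 := hw
      simp only [mem_ofPred_eq, map_add, map_smul, map_neg, hA1, smul_eq_mul]; linarith⟩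
    (fun w (hw : _ < (0 : ℝ)) => hw.le)
  obtain ⟨L₂, h₂⟩ := key {w | B w < 0} {w | B w ≤ 0}
    ((convex_Iio (0 : ℝ)).linear_preimage B) (fun w hw => Or.inr (Or.inl hw))
    ⟨-d₂, fun w hw η hη => by
      have : B w ≤ 0 := hw
      simp only [mem_ofPred_eq, map_add, map_smul, map_neg, hB2, smul_eq_mul]; linarith⟩
    (fun w (hw : _ < (0 : ℝ)) => hw.le)
  obtain ⟨L₃, h₃⟩ := key ({w | 0 < A w} ∩ {w | 0 < B w}) ({w | 0 ≤ A w} ∩ {w | 0 ≤ B w})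
    (((convex_Ioi (0 : ℝ)).linear_preimage A).inter ((convex_Ioi (0 : ℝ)).linear_preimage B))
    (fun w hw => Or.inr (Or.inr hw))
    ⟨d₁ + d₂, fun w hw η hη => by
      have h1 : 0 ≤ A w := hw.1
      have h2 : 0 ≤ B w := hw.2
      constructor <;> simp only [mem_ofPred_eq, map_add, map_smul, hA1, hA2, hB1, hB2,
        smul_eq_mul] <;> linarith⟩
    (fun w hw => ⟨(show 0 < A w from hw.1).le, (show 0 < B w from hw.2).le⟩)
  have hsmall : ∀ v : ℂ, ∃ ε : ℝ, 0 < ε ∧ ε • v ∈ Metric.ball (0 : ℂ) r ∧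
      (-ε) • v ∈ Metric.ball (0 : ℂ) r := by
    intro v
    refine ⟨r / (2 * (‖v‖ + 1)), by positivity, ?_⟩
    have : ‖(r / (2 * (‖v‖ + 1))) • v‖ < r := by
      rw [norm_smul, Real.norm_of_nonneg (by positivity), div_mul_eq_mul_div,
        div_lt_iff₀ (by positivity)]
      nlinarith [norm_nonneg v]
    rw [neg_smul, mem_ball_zero_iff, mem_ball_zero_iff, norm_neg]
    exact ⟨this, this⟩
  obtain ⟨ε₁, hε₁, hb₁, hb₁'⟩ := hsmall d₁
  obtain ⟨ε₂, hε₂, hb₂, hb₂'⟩ := hsmall d₂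
  have cancel : ∀ (a : ℝ) (v : ℂ) (L L' : ℂ →ₗ[ℝ] ℝ), a ≠ 0 → L (a • v) = L' (a • v) →
      L v = L' v := by
    intro a v L L' ha hL
    rw [map_smul, map_smul] at hL
    exact mul_left_cancel₀ ha hL
  have e1 : L₂ d₁ = L₃ d₁ := by
    refine cancel ε₁ _ _ _ hε₁.ne' ?_
    rw [← h₂ _ ⟨hb₁, by simp [-Complex.real_smul, hB1]⟩,
      ← h₃ _ ⟨hb₁, by simp [-Complex.real_smul, hA1, hε₁.le], by simp [-Complex.real_smul, hB1]⟩]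
  have e2 : L₁ d₂ = L₃ d₂ := by
    refine cancel ε₂ _ _ _ hε₂.ne' ?_
    rw [← h₁ _ ⟨hb₂, by simp [-Complex.real_smul, hA2]⟩,
      ← h₃ _ ⟨hb₂, by simp [-Complex.real_smul, hA2], by simp [-Complex.real_smul, hB2, hε₂.le]⟩]
  have e3 : L₁ d₁ = L₂ d₁ := by
    refine cancel (-ε₁) _ _ _ (by linarith) ?_
    rw [← h₁ _ ⟨hb₁', by simp [-Complex.real_smul, hA1, hε₁.le]⟩,
      ← h₂ _ ⟨hb₁', by simp [-Complex.real_smul, hB1]⟩]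
  have e4 : L₁ d₂ = L₂ d₂ := by
    refine cancel (-ε₂) _ _ _ (by linarith) ?_
    rw [← h₁ _ ⟨hb₂', by simp [-Complex.real_smul, hA2]⟩,
      ← h₂ _ ⟨hb₂', by simp [-Complex.real_smul, hB2, hε₂.le]⟩]
  have h12 : ∀ w, L₂ w = L₁ w := fun w => by
    rw [hAB w]; simp only [map_add, map_smul, e3, e4]
  have h13 : ∀ w, L₃ w = L₁ w := fun w => by
    rw [hAB w]; simp only [map_add, map_smul, e3, e1, e2]
  refine ⟨L₁, fun w hw => ?_⟩
  by_cases hA : A w ≤ 0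
  · exact h₁ w ⟨hw, hA⟩
  by_cases hB : B w ≤ 0
  · rw [h₂ w ⟨hw, hB⟩, h12]
  · rw [h₃ w ⟨hw, (not_le.1 hA).le, (not_le.1 hB).le⟩, h13]

/-! ### Pressures that do not depend on the vertical coordinate -/

section Crease

variable {K : SimplicialComplex ℝ E3} {q : E3} {p : E3 → ℝ} {s : Finset E3}

theorem MemPressure.homothety (hp : MemPressure K (vertexMacro K q) p) {x : E3}
    (hx : x ∈ vertexMacro K q) {t : ℝ} (h0 : 0 ≤ t) (h1 : t ≤ 1) :
    p (q + t • (x - q)) - p q = t * (p x - p q) := by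
  obtain ⟨s, hs, hxs⟩ := mem_vertexMacro.1 hx
  obtain ⟨f, hf⟩ := hp.isP1On hs
  rw [hf _ (homothety_mem hs hxs h0 h1), hf x hxs, hf q (center_mem_element hs), affine_homothety]
  ring

/-- A pressure whose vertical derivative vanishes on each element is constant along vertical
segments. -/
theorem MemPressure.eq_of_vertical (h : IsInteriorVertex K q)
    (hp : MemPressure K (vertexMacro K q) p)
    (hz : ∀ s ∈ vertexStar K q, ∀ f : E3 →ᵃ[ℝ] ℝ, EqOn p f (convexHull ℝ (s : Set E3)) →
      f.linear (axis 2) = 0) {x : E3} {c : ℝ}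
    (hseg : ∀ t ∈ Icc (0 : ℝ) 1, x + t • (c • axis 2) ∈ vertexMacro K q) :
    p (x + c • axis 2) = p x := by
  let g : ℝ → E3 := fun t => x + t • (c • axis 2)
  have hg : Continuous g := by fun_prop
  have key := abs_sub_le_of_finite_closed_cover (ι := Finset E3)
    (A := fun s => g ⁻¹' {y | s ∈ vertexStar K q ∧ y ∈ convexHull ℝ (s : Set E3)})
    (fun s => by
      refine IsClosed.preimage hg ?_
      by_cases hs : s ∈ vertexStar K q
      · simpa [hs] using isClosed_element s
      · simp [hs]) (h := p ∘ g) (C := 0)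
    (fun s a ha b hb => by
      obtain ⟨hs, ha⟩ := ha
      obtain ⟨-, hb⟩ := hb
      obtain ⟨f, hf⟩ := hp.isP1On hs
      simp only [Function.comp, hf _ ha, hf _ hb]
      rw [affineMap_eq_linear_add f (g b) (g a)]
      have : g b - g a = ((b - a) * c) • axis 2 := by
        simp only [g, smul_smul, sub_mul, sub_smul]; abel
      rw [this, map_smul, hz s hs f hf]
      simp) 1 h.finite.toFinset 0 zero_le_one (fun t ht => by
      obtain ⟨s, hs, hxs⟩ := mem_vertexMacro.1 (hseg t ht)
      simp only [mem_iUnion]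
      exact ⟨s, h.finite.mem_toFinset.2 hs, hs, hxs⟩)
  simp only [zero_mul] at key
  have := abs_nonpos_iff.1 key
  simpa [g, sub_eq_zero] using this

/-- A pressure without vertical derivative that is not affine has creases. They lie in vertical
semi-planes formed by faces of elements, and they cannot all be contained in two semi-planes that
span independent directions. -/
theorem MemPressure.exists_inSkeleton (h : IsInteriorVertex K q)
    (hp : MemPressure K (vertexMacro K q) p)
    (hz : ∀ s ∈ vertexStar K q, ∀ f : E3 →ᵃ[ℝ] ℝ, EqOn p f (convexHull ℝ (s : Set E3)) →
      f.linear (axis 2) = 0)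
    (hna : ¬ ∃ f : E3 →ᵃ[ℝ] ℝ, EqOn p f (vertexMacro K q)) {d₁ d₂ : ℂ} (hd : planeDet d₁ d₂ ≠ 0) :
    ∃ w : ℂ, w ≠ 0 ∧ InSkeleton K q w ∧ (∀ a : ℝ, 0 ≤ a → w ≠ a • d₁) ∧
      ∀ a : ℝ, 0 ≤ a → w ≠ a • d₂ := by
  by_contra hcon
  refine hna ?_
  obtain ⟨r, hr, hball⟩ := Metric.mem_nhds_iff.1 h.mem_nhds
  set F : ℂ → ℝ := fun w => p (q + lift w) - p q with hFdef
  have hlift : ∀ w ∈ Metric.ball (0 : ℂ) r, q + lift w ∈ Metric.ball q r := fun w hw => by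
    rw [mem_ball_iff_norm, add_sub_cancel_left, norm_lift]
    simpa using hw
  have hFc : ContinuousOn F (Metric.ball 0 r) := by
    refine ContinuousOn.sub ?_ continuousOn_const
    exact hp.1.comp (by fun_prop) fun w hw => hball (hlift w hw)
  -- on the ball, the pressure is a function of the projection
  have hpF : ∀ x ∈ Metric.ball q r, p x = p q + F (horiz (x - q)) := by
    intro x hx
    have hb : q + lift (horiz (x - q)) ∈ Metric.ball q r := by
      rw [mem_ball_iff_norm, add_sub_cancel_left]
      exact (norm_lift_horiz_le _).trans_lt (mem_ball_iff_norm.1 hx)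
    have hx' : q + lift (horiz (x - q)) + (x - q) 2 • axis 2 = x := by
      rw [add_assoc, lift_horiz_add]; abel
    have := hp.eq_of_vertical h hz (x := q + lift (horiz (x - q))) (c := (x - q) 2)
      (fun t ht => hball (by
        have h1 := (convex_ball q r).add_smul_sub_mem hb hx ht
        have h2 : x - (q + lift (horiz (x - q))) = (x - q) 2 • axis 2 := by
          nth_rewrite 1 [← hx']
          abel
        rwa [h2] at h1))
    rw [hx'] at this
    rw [this]
    simp [hFdef]
  have hhom : ∀ w ∈ Metric.ball (0 : ℂ) r, ∀ b : ℝ, 0 ≤ b → b ≤ 1 → F (b • w) = b * F w := by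
    intro w hw b hb0 hb1
    have := hp.homothety (hball (hlift w hw)) hb0 hb1
    rw [add_sub_cancel_left] at this
    simp only [hFdef, map_smul, this]
  obtain ⟨L, hL⟩ := exists_linearMap_of_two_rays hr hFc hd (fun w hw hw0 hw1 hw2 => by
    have hns : ¬ InSkeleton K q w := fun hs => hcon ⟨w, hw0, hs, hw1, hw2⟩
    simp only [InSkeleton, not_forall, not_disjoint_iff] at hns
    obtain ⟨s, hs, y, hy, a, ha, hya⟩ := hns
    obtain ⟨f, hf⟩ := hp.isP1On hs
    -- a point of the interior off the vertical line through `q`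
    have t1 : Filter.Tendsto (fun ε : ℝ => y + ε • lift w) (nhdsWithin 0 (Ioi 0)) (nhds y) :=
    tendsto_add_smul _ _
    obtain ⟨ε, hε, hε0⟩ := ((t1.eventually (isOpen_interior.mem_nhds hy)).and
      self_mem_nhdsWithin).exists
    have hε0 : 0 < ε := hε0
    set y' := y + ε • lift w with hy'
    have hyw : horiz (y' - q) = (a + ε) • w := by
      rw [hy', add_sub_right_comm, map_add, hya, map_smul, horiz_lift, add_smul]
    -- contract it into the ball
    have t2 : Filter.Tendsto (fun t : ℝ => q + t • (y' - q)) (nhdsWithin 0 (Ioi 0)) (nhds q) :=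
    tendsto_add_smul _ _
    have t3 : Filter.Tendsto (fun t : ℝ => t * (a + ε)) (nhdsWithin 0 (Ioi 0)) (nhds 0) := by
      refine Filter.Tendsto.mono_left ?_ nhdsWithin_le_nhds
      have : Continuous (fun t : ℝ => t * (a + ε)) := by fun_prop
      simpa using this.tendsto 0
    obtain ⟨t, ⟨⟨ht1, ht2⟩, ht3⟩, ht0⟩ := (((t2.eventually (Metric.ball_mem_nhds q hr)).and
      (t3.eventually (Iio_mem_nhds (show (0 : ℝ) < 1 by norm_num)))).and
      (nhdsWithin_le_nhds (Iio_mem_nhds (show (0 : ℝ) < 1 by norm_num)))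
      |>.and self_mem_nhdsWithin).exists
    have ht0 : 0 < t := ht0
    have ht2 : t * (a + ε) < 1 := ht2
    have ht3 : t < 1 := ht3
    set b := t * (a + ε) with hb
    have hb0 : 0 < b := by positivity
    set z := q + t • (y' - q) with hzdef
    have hzi : z ∈ interior (convexHull ℝ (s : Set E3)) :=
      homothety_mem_interior hs hε ht0 ht3.le
    have hzw : horiz (z - q) = b • w := by
      rw [hzdef, add_sub_cancel_left, map_smul, hyw, smul_smul]
    have t4 : Filter.Tendsto (fun v : ℂ => z + b • lift (v - w)) (nhds w) (nhds z) := by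
      have : Continuous (fun v : ℂ => z + b • lift (v - w)) := by fun_prop
      simpa using this.tendsto w
    refine ⟨f.linear.comp (lift : ℂ →ₗ[ℝ] E3), ?_⟩
    filter_upwards [t4.eventually (isOpen_interior.mem_nhds hzi),
      t4.eventually (Metric.isOpen_ball.mem_nhds ht1), Metric.isOpen_ball.mem_nhds hw]
      with v hv1 hv2 hv3
    have e1 := hpF _ hv2
    have e2 : horiz (z + b • lift (v - w) - q) = b • v := by
      rw [add_sub_right_comm, map_add, hzw, map_smul, horiz_lift, ← smul_add]; simp
    rw [e2, hhom v hv3 b hb0.le ht2.le, hf _ (interior_subset hv1),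
      affineMap_eq_linear_add f _ q, ← hf q (center_mem_element hs)] at e1
    have e3 := lift_horiz_add (z + b • lift (v - w) - q)
    rw [e2] at e3
    rw [← e3, map_add, map_smul, map_smul, map_smul, hz s hs f hf] at e1
    have e4 : b * f.linear (lift v) = b * F v := by simpa using e1
    exact (mul_left_cancel₀ hb0.ne' e4).symm)
  refine ⟨(L.comp (horiz : E3 →ₗ[ℝ] ℂ)).toAffineMap + AffineMap.const ℝ E3 (p q - L (horiz q)),
    fun x hx => ?_⟩
  have t1 : Filter.Tendsto (fun t : ℝ => q + t • (x - q)) (nhdsWithin 0 (Ioi 0)) (nhds q) :=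
    tendsto_add_smul _ _
  obtain ⟨t, ⟨ht1, ht3⟩, ht0⟩ := ((t1.eventually (Metric.ball_mem_nhds q hr)).and
    (nhdsWithin_le_nhds (Iio_mem_nhds (show (0 : ℝ) < 1 by norm_num)))
    |>.and self_mem_nhdsWithin).exists
  have ht0 : 0 < t := ht0
  have ht3 : t < 1 := ht3
  have e1 := hp.homothety hx ht0.le ht3.le
  have e2 : horiz (q + t • (x - q) - q) = t • horiz (x - q) := by
    rw [add_sub_cancel_left, map_smul]
  have hmem : t • horiz (x - q) ∈ Metric.ball (0 : ℂ) r := by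
    rw [mem_ball_zero_iff, ← norm_lift, ← e2]
    exact (norm_lift_horiz_le _).trans_lt (mem_ball_iff_norm.1 ht1)
  rw [hpF _ ht1, e2, hL _ hmem, map_smul, add_sub_cancel_left, smul_eq_mul] at e1
  have e3 := mul_left_cancel₀ ht0.ne' e1
  simp only [AffineMap.coe_add, LinearMap.coe_toAffineMap, Pi.add_apply, LinearMap.comp_apply,
    AffineMap.const_apply, ContinuousLinearMap.coe_coe]
  rw [map_sub, map_sub] at e3
  linarith

end Crease

/-! ### Angles measured from a ray -/

/-- The angle from `d` to `u`, diminished by `π`: it jumps from `π` to `-π` when `u` crosses the ray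
of `d` counterclockwise and is continuous elsewhere. -/
noncomputable def angleFrom (d u : ℂ) : ℝ := Complex.arg (-(u / d))

theorem neg_div_mem_slitPlane {d u : ℂ} (hd : d ≠ 0) (h : ∀ a : ℝ, 0 ≤ a → u ≠ a • d) :
    -(u / d) ∈ Complex.slitPlane := by
  rw [Complex.mem_slitPlane_iff]
  by_contra hcon
  push Not at hcon
  obtain ⟨h1, h2⟩ := hcon
  refine h (u / d).re (by simpa using h1) ?_
  have : ((u / d).re : ℂ) = u / d := by
    apply Complex.ext
    · simp
    · have h3 : (u / d).im = 0 := by simpa using h2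
      rw [Complex.ofReal_im, h3]
  rw [Complex.real_smul, this, div_mul_cancel₀ _ hd]

theorem continuousAt_angleFrom {d u : ℂ} (hd : d ≠ 0) (h : ∀ a : ℝ, 0 ≤ a → u ≠ a • d) :
    ContinuousAt (angleFrom d) u := by
  have h1 := Complex.continuousAt_arg (neg_div_mem_slitPlane hd h)
  have h2 : ContinuousAt (fun u : ℂ => -(u / d)) u := by fun_prop
  exact ContinuousAt.comp (f := fun u : ℂ => -(u / d)) (x := u) h1 h2

theorem exists_pos_smul_of_angleFrom_eq {d d' u : ℂ} (hd : d ≠ 0) (hd' : d' ≠ 0) (hu : u ≠ 0)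
    (h : angleFrom d u = angleFrom d' u) : ∃ a : ℝ, 0 < a ∧ d = a • d' := by
  have h1 : -(u / d) ≠ 0 := neg_ne_zero.2 (div_ne_zero hu hd)
  have h2 : -(u / d') ≠ 0 := neg_ne_zero.2 (div_ne_zero hu hd')
  have h3 := (Complex.arg_eq_arg_iff h1 h2).1 h
  set a : ℝ := ‖-(u / d')‖ / ‖-(u / d)‖ with ha
  refine ⟨a, div_pos (norm_pos_iff.2 h2) (norm_pos_iff.2 h1), ?_⟩
  have h4 : (a : ℂ) * -(u / d) = -(u / d') := by
    rw [← h3, ha]; push_cast; ring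
  rw [Complex.real_smul]
  field_simp at h4
  linear_combination h4

theorem angleFrom_smul (d d' : ℂ) {a : ℝ} (ha : 0 < a) (z : ℂ) :
    angleFrom d' (a • (z * d)) = Complex.arg (-(z * (d / d'))) := by
  rw [angleFrom, Complex.real_smul, ← Complex.arg_real_mul (-(z * (d / d'))) ha]
  congr 1
  ring

/-- The complex number `1 + σ t i`. For small `t > 0`, multiplication by it turns a direction by a
small angle of the sign of `σ`, up to scaling. -/
noncomputable def tilt (σ t : ℝ) : ℂ := ⟨1, σ * t⟩

theorem continuous_tilt (σ : ℝ) : Continuous (tilt σ) := by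
  have : tilt σ = fun t : ℝ => (1 : ℂ) + ((σ * t : ℝ) : ℂ) * Complex.I := by
    ext t; apply Complex.ext <;> simp [tilt]
  rw [this]
  fun_prop

theorem tendsto_tilt (σ : ℝ) : Filter.Tendsto (tilt σ) (nhdsWithin 0 (Ioi 0)) (nhds 1) := by
  refine Filter.Tendsto.mono_left ?_ nhdsWithin_le_nhds
  have := (continuous_tilt σ).tendsto 0
  have h1 : tilt σ 0 = 1 := by apply Complex.ext <;> simp [tilt]
  rwa [h1] at this

theorem tendsto_arg_neg_tilt_one :
    Filter.Tendsto (fun t => Complex.arg (-tilt 1 t)) (nhdsWithin 0 (Ioi 0)) (nhds (-Real.pi)) := by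
  refine (Complex.tendsto_arg_nhdsWithin_im_neg_of_re_neg_of_im_zero (z := -1) (by simp)
    (by simp)).comp (tendsto_nhdsWithin_iff.2 ⟨(tendsto_tilt 1).neg, ?_⟩)
  filter_upwards [self_mem_nhdsWithin] with t ht
  simpa [tilt] using ht

theorem tendsto_arg_neg_tilt_neg_one :
    Filter.Tendsto (fun t => Complex.arg (-tilt (-1) t)) (nhdsWithin 0 (Ioi 0))
      (nhds Real.pi) := by
  refine (Complex.tendsto_arg_nhdsWithin_im_nonneg_of_re_neg_of_im_zero (z := -1) (by simp)
    (by simp)).comp (tendsto_nhdsWithin_iff.2 ⟨(tendsto_tilt (-1)).neg, ?_⟩)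
  filter_upwards [self_mem_nhdsWithin] with t ht
  simpa [tilt] using le_of_lt ht

theorem tendsto_arg_neg_tilt_mul (σ : ℝ) {z : ℂ} (hz : -z ∈ Complex.slitPlane) :
    Filter.Tendsto (fun t => Complex.arg (-(tilt σ t * z))) (nhdsWithin 0 (Ioi 0))
      (nhds (Complex.arg (-z))) := by
  have h1 : Filter.Tendsto (fun t => -(tilt σ t * z)) (nhdsWithin 0 (Ioi 0)) (nhds (-z)) := by
    have := ((tendsto_tilt σ).mul_const z).neg
    rwa [one_mul] at this
  exact (Complex.continuousAt_arg hz).tendsto.comp h1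

theorem ray_ne_of_semiplane_ne {q : E3} {d d' : ℂ} (hd : d ≠ 0)
    (h : semiplane q d ≠ semiplane q d') : ∀ a : ℝ, 0 ≤ a → d ≠ a • d' := by
  intro a ha hda
  refine h ((semiplane_eq_iff hd).2 ⟨a, lt_of_le_of_ne ha ?_, hda⟩)
  rintro rfl
  exact hd (by simp [hda])

/-! ### Splitting the macro-element along semi-planes -/

section Split

variable {K : SimplicialComplex ℝ E3} {q : E3} {s : Finset E3} {D : Finset ℂ} {d d' : ℂ} {x : E3}

/-- A finite set of rays, given by their directions, such that the vertical semi-planes over them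
are distinct and contained in the skeleton of the mesh. -/
structure IsSkeletonFan (K : SimplicialComplex ℝ E3) (q : E3) (D : Finset ℂ) : Prop where
  ne_zero : ∀ d ∈ D, d ≠ 0
  injOn : ∀ d ∈ D, ∀ d' ∈ D, d ≠ d' → semiplane q d ≠ semiplane q d'
  inSkeleton : ∀ d ∈ D, InSkeleton K q d

/-- The elements around `q` in the sector that follows the ray of `d` counterclockwise: among the
rays of `D`, the one of `d` is the last before the element. -/
def sector (K : SimplicialComplex ℝ E3) (q : E3) (D : Finset ℂ) (d : ℂ) : Set (Finset E3) :=
  {s | s ∈ vertexStar K q ∧ ∀ x ∈ interior (convexHull ℝ (s : Set E3)), ∀ d' ∈ D, d' ≠ d →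
    angleFrom d (horiz (x - q)) < angleFrom d' (horiz (x - q))}

theorem horiz_ne_smul_of_notMem (hx : x ∉ semiplane q d) :
    ∀ a : ℝ, 0 ≤ a → horiz (x - q) ≠ a • d := fun a ha h => hx ⟨a, ha, h⟩

theorem horiz_ne_zero_of_notMem (hx : x ∉ semiplane q d) : horiz (x - q) ≠ 0 := fun h =>
  hx (axis_mem_semiplane d h)

theorem continuousAt_angleFrom_horiz (hd : d ≠ 0) (hx : x ∉ semiplane q d) :
    ContinuousAt (fun y => angleFrom d (horiz (y - q))) x := by
  have h1 := continuousAt_angleFrom hd (horiz_ne_smul_of_notMem hx)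
  have h2 : ContinuousAt (fun y : E3 => horiz (y - q)) x := by fun_prop
  exact ContinuousAt.comp (f := fun y : E3 => horiz (y - q)) (x := x) h1 h2

theorem IsSkeletonFan.angleFrom_ne (hD : IsSkeletonFan K q D) (hd : d ∈ D) (hd' : d' ∈ D)
    (hne : d ≠ d') (hx : x ∉ semiplane q d) :
    angleFrom d (horiz (x - q)) ≠ angleFrom d' (horiz (x - q)) := fun h =>
  hD.injOn d hd d' hd' hne ((semiplane_eq_iff (hD.ne_zero d hd)).2
    (exists_pos_smul_of_angleFrom_eq (hD.ne_zero d hd) (hD.ne_zero d' hd')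
      (horiz_ne_zero_of_notMem hx) h))

/-- Each element around `q` lies in one of the sectors. -/
theorem IsSkeletonFan.exists_sector (hD : IsSkeletonFan K q D) (hne : D.Nonempty)
    (hs : s ∈ vertexStar K q) : ∃ d ∈ D, s ∈ sector K q D d := by
  have hoff : ∀ d ∈ D, ∀ x ∈ interior (convexHull ℝ (s : Set E3)), x ∉ semiplane q d :=
    fun d hd x hx hxd => Set.disjoint_left.1 (hD.inSkeleton d hd s hs) hx hxd
  have hcont : ∀ d ∈ D, ContinuousOn (fun y => angleFrom d (horiz (y - q)))
      (interior (convexHull ℝ (s : Set E3))) := fun d hd x hx =>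
    (continuousAt_angleFrom_horiz (hD.ne_zero d hd) (hoff d hd x hx)).continuousWithinAt
  obtain ⟨x₀, hx₀⟩ := interior_convexHull_nonempty hs.1
  obtain ⟨d, hd, hmin⟩ := D.exists_min_image (fun d => angleFrom d (horiz (x₀ - q))) hne
  refine ⟨d, hd, hs, fun x hx d' hd' hne' => ?_⟩
  by_contra hle
  have hconn := (convex_convexHull ℝ (s : Set E3)).interior.isPreconnected
  obtain ⟨y, hy, hyeq⟩ := hconn.intermediate_value₂ hx₀ hx (hcont d hd) (hcont d' hd') (hmin d' hd') (not_lt.1 hle)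
  exact hD.angleFrom_ne hd hd' hne'.symm (hoff d hd y hy) hyeq

theorem IsSkeletonFan.lt_of_mem_region (hD : IsSkeletonFan K q D) (hd : d ∈ D)
    (hx : x ∈ region (sector K q D d)) (hoff : ∀ d ∈ D, x ∉ semiplane q d) (hd' : d' ∈ D)
    (hne : d' ≠ d) : angleFrom d (horiz (x - q)) < angleFrom d' (horiz (x - q)) := by
  simp only [region, mem_iUnion] at hx
  obtain ⟨s, ⟨hs, hlt⟩, hxs⟩ := hx
  refine lt_of_le_of_ne ?_ (hD.angleFrom_ne hd hd' hne.symm (hoff d hd))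
  have hcl := element_subset_closure_interior hs.1 hxs
  have hcont : ∀ d ∈ D, ContinuousWithinAt (fun y => angleFrom d (horiz (y - q)))
      (interior (convexHull ℝ (s : Set E3))) x := fun d hd =>
    (continuousAt_angleFrom_horiz (hD.ne_zero d hd) (hoff d hd)).continuousWithinAt
  exact ContinuousWithinAt.closure_le (f := fun y => angleFrom d (horiz (y - q)))
    (g := fun y => angleFrom d' (horiz (y - q))) hcl (hcont d hd) (hcont d' hd')
    fun y hy => (hlt y hy d' hd' hne).le

theorem IsSkeletonFan.mem_region_of_lt (hD : IsSkeletonFan K q D) (hd : d ∈ D)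
    (hx : x ∈ vertexMacro K q) (hoff : ∀ d ∈ D, x ∉ semiplane q d)
    (hlt : ∀ d' ∈ D, d' ≠ d → angleFrom d (horiz (x - q)) < angleFrom d' (horiz (x - q))) :
    x ∈ region (sector K q D d) := by
  obtain ⟨s, hs, hxs⟩ := mem_vertexMacro.1 hx
  obtain ⟨e, he, hse⟩ := hD.exists_sector ⟨d, hd⟩ hs
  have hxe : x ∈ region (sector K q D e) := by
    simp only [region, mem_iUnion]; exact ⟨s, hse, hxs⟩
  rcases eq_or_ne e d with rfl | hne
  · exact hxe
  · exact absurd (hlt e he hne) (hD.lt_of_mem_region he hxe hoff hd hne.symm).not_gt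

theorem isClosed_region (h : IsInteriorVertex K q) {A : Set (Finset E3)}
    (hA : A ⊆ vertexStar K q) : IsClosed (region A) :=
  (h.finite.subset hA).isClosed_biUnion fun s _ => isClosed_element s

theorem sector_subset : sector K q D d ⊆ vertexStar K q := fun _ hs => hs.1

/-- A curve that approaches a point `x` over the ray of `d` from the side given by `σ`. -/
noncomputable def approach (x : E3) (a : ℝ) (d : ℂ) (σ t : ℝ) : E3 :=
  x + lift ((a + t) • (tilt σ t * d) - a • d)

theorem tendsto_approach (x : E3) (a : ℝ) (d : ℂ) (σ : ℝ) :
    Filter.Tendsto (approach x a d σ) (nhdsWithin 0 (Ioi 0)) (nhds x) := by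
  refine Filter.Tendsto.mono_left ?_ nhdsWithin_le_nhds
  have h1 : Continuous (approach x a d σ) := by
    unfold approach
    have := continuous_tilt σ
    fun_prop
  have h2 : tilt σ 0 = 1 := by apply Complex.ext <;> simp [tilt]
  have := h1.tendsto 0
  simpa [approach, h2] using this

theorem horiz_approach {a : ℝ} (hx : horiz (x - q) = a • d) (σ t : ℝ) :
    horiz (approach x a d σ t - q) = (a + t) • (tilt σ t * d) := by
  rw [approach, add_sub_right_comm, map_add, hx, horiz_lift]
  abel

theorem IsSkeletonFan.eventually_approach_notMem (hD : IsSkeletonFan K q D) (hd : d ∈ D) {a : ℝ}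
    (ha : 0 ≤ a) (hx : horiz (x - q) = a • d) {σ : ℝ} (hσ : σ ≠ 0) :
    ∀ᶠ t in nhdsWithin 0 (Ioi 0), ∀ e ∈ D, approach x a d σ t ∉ semiplane q e := by
  rw [Filter.eventually_all_finset]
  intro e he
  have hd0 := hD.ne_zero d hd
  have he0 := hD.ne_zero e he
  have hray : ∀ t : ℝ, 0 < t → approach x a d σ t ∈ semiplane q e →
      ∃ b : ℝ, 0 ≤ b ∧ tilt σ t * d = b • e := by
    rintro t ht ⟨b, hb, h⟩
    rw [horiz_approach hx] at h
    have hat : 0 < a + t := by linarith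
    refine ⟨(a + t)⁻¹ * b, by positivity, ?_⟩
    rw [← smul_smul, ← h, smul_smul, inv_mul_cancel₀ hat.ne', one_smul]
  rcases eq_or_ne e d with rfl | hne
  · filter_upwards [self_mem_nhdsWithin] with t ht hmem
    obtain ⟨b, -, h⟩ := hray t ht hmem
    rw [Complex.real_smul] at h
    have := congrArg Complex.im (mul_right_cancel₀ he0 h)
    simp only [tilt, Complex.ofReal_im] at this
    exact (mul_ne_zero hσ (ne_of_gt ht)) this
  · have hsl : -(d / e) ∈ Complex.slitPlane := neg_div_mem_slitPlane he0
      (ray_ne_of_semiplane_ne hd0 (hD.injOn d hd e he hne.symm))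
    have h1 : Filter.Tendsto (fun t => -(tilt σ t * (d / e))) (nhdsWithin 0 (Ioi 0))
        (nhds (-(d / e))) := by
      have := ((tendsto_tilt σ).mul_const (d / e)).neg
      rwa [one_mul] at this
    filter_upwards [h1.eventually (Complex.isOpen_slitPlane.mem_nhds hsl), self_mem_nhdsWithin]
      with t ht ht0 hmem
    obtain ⟨b, hb, h⟩ := hray t ht0 hmem
    have h2 : -(tilt σ t * (d / e)) = ((-b : ℝ) : ℂ) := by
      rw [← mul_div_assoc, h, Complex.real_smul, mul_div_cancel_right₀ _ he0]; simp
    have h3 : -(tilt σ t * (d / e)) ∈ Complex.slitPlane := ht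
    rw [h2, Complex.ofReal_mem_slitPlane] at h3
    linarith

/-- The points over the ray of `d` belong to the sector that follows it. -/
theorem IsSkeletonFan.mem_region_after (h : IsInteriorVertex K q) (hD : IsSkeletonFan K q D)
    (hd : d ∈ D) (hx : x ∈ semiplane q d) (hxM : x ∈ interior (vertexMacro K q)) :
    x ∈ region (sector K q D d) := by
  obtain ⟨a, ha, hxa⟩ := hx
  have hd0 := hD.ne_zero d hd
  refine (isClosed_region h sector_subset).mem_of_tendsto (tendsto_approach x a d 1) ?_
  have hev : ∀ᶠ t in nhdsWithin 0 (Ioi 0), ∀ e ∈ D, e ≠ d →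
      angleFrom d (horiz (approach x a d 1 t - q)) <
        angleFrom e (horiz (approach x a d 1 t - q)) := by
    rw [Filter.eventually_all_finset]
    intro e he
    rcases eq_or_ne e d with rfl | hne
    · exact Filter.Eventually.of_forall fun _ h => absurd rfl h
    · have hsl : -(d / e) ∈ Complex.slitPlane := neg_div_mem_slitPlane (hD.ne_zero e he)
        (ray_ne_of_semiplane_ne hd0 (hD.injOn d hd e he hne.symm))
      filter_upwards [tendsto_arg_neg_tilt_one.eventually_lt (tendsto_arg_neg_tilt_mul 1 hsl)
        (Complex.neg_pi_lt_arg _), self_mem_nhdsWithin] with t ht ht0 _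
      have ht0 : 0 < t := ht0
      rw [horiz_approach hxa, angleFrom_smul _ _ (by linarith), angleFrom_smul _ _ (by linarith),
        div_self hd0, mul_one]
      exact ht
  filter_upwards [hev, hD.eventually_approach_notMem hd ha hxa one_ne_zero,
    (tendsto_approach x a d 1).eventually (mem_interior_iff_mem_nhds.1 hxM)] with t h1 h2 h3
  exact hD.mem_region_of_lt hd h3 h2 h1

/-- The points over the ray of `d` belong to a sector other than the one that follows the ray. -/
theorem IsSkeletonFan.exists_mem_region_before (h : IsInteriorVertex K q)
    (hD : IsSkeletonFan K q D) (hd : d ∈ D) (hcard : 2 ≤ D.card) (hx : x ∈ semiplane q d)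
    (hxM : x ∈ interior (vertexMacro K q)) : ∃ e ∈ D, e ≠ d ∧ x ∈ region (sector K q D e) := by
  classical
  obtain ⟨a, ha, hxa⟩ := hx
  have hd0 := hD.ne_zero d hd
  obtain ⟨e, he, hne⟩ := Finset.exists_mem_ne (by omega : 1 < D.card) d
  have hsl : -(d / e) ∈ Complex.slitPlane := neg_div_mem_slitPlane (hD.ne_zero e he)
    (ray_ne_of_semiplane_ne hd0 (hD.injOn d hd e he hne.symm))
  have hcl : IsClosed (⋃ e ∈ D.erase d, region (sector K q D e)) :=
    isClosed_biUnion_finset fun _ _ => isClosed_region h sector_subset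
  have hmem : x ∈ ⋃ e ∈ D.erase d, region (sector K q D e) := by
    refine hcl.mem_of_tendsto (tendsto_approach x a d (-1)) ?_
    filter_upwards [(tendsto_arg_neg_tilt_mul (-1) hsl).eventually_lt tendsto_arg_neg_tilt_neg_one
        (lt_of_le_of_ne (Complex.arg_le_pi _) (Complex.mem_slitPlane_iff_arg.1 hsl).1),
      self_mem_nhdsWithin,
      hD.eventually_approach_notMem hd ha hxa (by norm_num : (-1 : ℝ) ≠ 0),
      (tendsto_approach x a d (-1)).eventually (mem_interior_iff_mem_nhds.1 hxM)]
      with t ht ht0 h2 h3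
    have ht0 : 0 < t := ht0
    obtain ⟨s, hs, hys⟩ := mem_vertexMacro.1 h3
    obtain ⟨e', he', hse'⟩ := hD.exists_sector ⟨d, hd⟩ hs
    have hy : approach x a d (-1) t ∈ region (sector K q D e') := by
      simp only [region, mem_iUnion]; exact ⟨s, hse', hys⟩
    simp only [mem_iUnion]
    refine ⟨e', Finset.mem_erase.2 ⟨?_, he'⟩, hy⟩
    rintro rfl
    have := hD.lt_of_mem_region he' hy h2 he hne
    rw [horiz_approach hxa, angleFrom_smul _ _ (by linarith), angleFrom_smul _ _ (by linarith),
      div_self hd0, mul_one] at this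
    exact this.not_gt ht
  simp only [mem_iUnion] at hmem
  obtain ⟨e, he, hxe⟩ := hmem
  exact ⟨e, Finset.mem_of_mem_erase he, Finset.ne_of_mem_erase he, hxe⟩

/-- A vertex is not the midpoint of a vertical segment within an element. -/
theorem not_vertical_segment (hs : s ∈ vertexStar K q) {c : ℝ} (hc : c ≠ 0)
    (h1 : q + c • axis 2 ∈ convexHull ℝ (s : Set E3)) :
    q - c • axis 2 ∉ convexHull ℝ (s : Set E3) := by
  intro h2
  have hmid : ∀ f : E3 →ᵃ[ℝ] ℝ, f (q - c • axis 2) - f q = -(f (q + c • axis 2) - f q) := by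
    intro f
    have := affine_homothety (q := q) f (q + c • axis 2) (-1)
    rw [add_sub_cancel_left, neg_one_smul, ← sub_eq_add_neg] at this
    rw [this]; ring
  rw [convexHull_eq_bary hs.1] at h1 h2
  have hzero : ∀ v ∈ s, v ≠ q → bary hs.1 v (q + c • axis 2) = 0 := by
    intro v hv hvq
    have e1 := h1 v hv
    have e2 := h2 v hv
    have e3 := hmid (bary hs.1 v)
    rw [bary_ne hs.1 hs.2 hvq.symm] at e3
    linarith
  have hval : ∀ f : E3 →ᵃ[ℝ] ℝ, f (q + c • axis 2) = f q * bary hs.1 q (q + c • axis 2) := by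
    intro f
    rw [affineMap_apply_eq_sum hs.1 f, Finset.sum_eq_single q]
    · intro v hv hvq
      rw [hzero v hv hvq, mul_zero]
    · exact fun h => absurd hs.2 h
  have e1 := hval (AffineMap.const ℝ E3 1)
  simp only [AffineMap.const_apply, one_mul] at e1
  have e2 := hval (EuclideanSpace.proj (2 : Fin 3) : E3 →L[ℝ] ℝ).toLinearMap.toAffineMap
  rw [← e1, mul_one] at e2
  exact hc (by simpa [axis] using e2)

theorem isConnected_region {A : Set (Finset E3)} (hA : A ⊆ vertexStar K q) (hne : A.Nonempty) :
    IsConnected (region A) := by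
  obtain ⟨s, hs⟩ := hne
  refine (StarConvex.isPathConnected (a := q) ?_ ?_).isConnected
  · refine starConvex_iUnion₂ fun s hs => ?_
    exact (convex_convexHull ℝ _).starConvex (center_mem_element (hA hs))
  · simp only [region, mem_iUnion]
    exact ⟨s, hs, center_mem_element (hA hs)⟩

theorem eventually_add_smul_mem_interior (h : IsInteriorVertex K q) (v : E3) :
    ∀ᶠ c : ℝ in nhdsWithin 0 (Ioi 0), q + c • v ∈ interior (vertexMacro K q) :=
  (tendsto_add_smul q v).eventually
    (isOpen_interior.mem_nhds (mem_interior_iff_mem_nhds.2 h.mem_nhds))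

/-- A sector contains the vertical line through `q` near `q`, so it consists of at least two
elements. -/
theorem IsSkeletonFan.isMacroElement (h : IsInteriorVertex K q) (hD : IsSkeletonFan K q D)
    (hd : d ∈ D) : IsMacroElement K (region (sector K q D d)) := by
  obtain ⟨c, ⟨hc1, hc2⟩, hc⟩ := ((eventually_add_smul_mem_interior h (axis 2)).and
    (eventually_add_smul_mem_interior h (-axis 2)) |>.and self_mem_nhdsWithin).exists
  have hc : 0 < c := hc
  have m1 := hD.mem_region_after h hd (axis_mem_semiplane d (by simp)) hc1
  have m2 := hD.mem_region_after h hd (axis_mem_semiplane d (by simp)) hc2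
  simp only [region, mem_iUnion] at m1 m2
  obtain ⟨s, hs, h1⟩ := m1
  obtain ⟨t, ht, h2⟩ := m2
  refine ⟨isConnected_region sector_subset ⟨s, hs⟩, _, fun s hs => hs.1.1, ⟨s, hs, t, ht, ?_⟩, rfl⟩
  rintro rfl
  rw [smul_neg, ← sub_eq_add_neg] at h2
  exact not_vertical_segment hs.1 hc.ne' h1 h2

open Classical in
/-- Two or more vertical semi-planes within the skeleton of the mesh split the macro-element into
sectors. -/
theorem IsSkeletonFan.isSplitBy (h : IsInteriorVertex K q) (hD : IsSkeletonFan K q D)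
    (hcard : 2 ≤ D.card) : IsSplitBy K (vertexMacro K q) (D.image (semiplane q)) := by
  have hne : D.Nonempty := Finset.card_pos.1 (by omega)
  refine ⟨D.card, fun i => region (sector K q D (D.equivFin.symm i)), hcard,
    fun i => hD.isMacroElement h (D.equivFin.symm i).2, ?_, ?_, ?_⟩
  · refine Subset.antisymm (iUnion_subset fun i => ?_) fun x hx => ?_
    · exact biUnion_subset_biUnion_left sector_subset
    · obtain ⟨s, hs, hxs⟩ := mem_vertexMacro.1 hx
      obtain ⟨d, hd, hsd⟩ := hD.exists_sector hne hs
      refine mem_iUnion.2 ⟨D.equivFin ⟨d, hd⟩, ?_⟩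
      simp only [Equiv.symm_apply_apply, region, mem_iUnion]
      exact ⟨s, hsd, hxs⟩
  · intro i j hij x ⟨hxi, hxj⟩
    by_contra hx
    have hoff : ∀ d ∈ D, x ∉ semiplane q d := fun d hd hxd =>
      hx (mem_sUnion.2 ⟨_, Finset.mem_coe.2 (Finset.mem_image_of_mem _ hd), hxd⟩)
    have hne' : (D.equivFin.symm i : ℂ) ≠ D.equivFin.symm j := fun h =>
      hij (D.equivFin.symm.injective (Subtype.ext h))
    exact (hD.lt_of_mem_region (D.equivFin.symm i).2 hxi hoff (D.equivFin.symm j).2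
      hne'.symm).not_gt (hD.lt_of_mem_region (D.equivFin.symm j).2 hxj hoff
        (D.equivFin.symm i).2 hne')
  · intro P hP
    obtain ⟨d, hd, rfl⟩ := Finset.mem_image.1 hP
    obtain ⟨c, hcM, hc⟩ := ((eventually_add_smul_mem_interior h (lift d)).and
      self_mem_nhdsWithin).exists
    have hc : 0 < c := hc
    have hhor : horiz (q + c • lift d - q) = c • d := by
      rw [add_sub_cancel_left, map_smul, horiz_lift]
    have hx : q + c • lift d ∈ semiplane q d := ⟨c, hc.le, hhor⟩
    obtain ⟨e, he, hed, hxe⟩ := hD.exists_mem_region_before h hd hcard hx hcM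
    refine ⟨D.equivFin ⟨d, hd⟩, D.equivFin ⟨e, he⟩, ?_, fun hsub => ?_⟩
    · intro heq
      exact hed (congrArg Subtype.val (D.equivFin.injective heq)).symm
    · have hmem := hsub ⟨by simpa using hD.mem_region_after h hd hx hcM, by simpa using hxe⟩
      obtain ⟨P, ⟨hP, hPd⟩, hxP⟩ := hmem
      obtain ⟨e', -, rfl⟩ := Finset.mem_image.1 (Finset.mem_coe.1 hP)
      obtain ⟨b, hb, hxb⟩ := hxP
      rw [hhor] at hxb
      refine ray_ne_of_semiplane_ne (hD.ne_zero d hd) (Ne.symm hPd) (c⁻¹ * b) (by positivity) ?_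
      rw [← smul_smul, ← hxb, smul_smul, inv_mul_cancel₀ hc.ne', one_smul]

end Split

/-! ### Semi-planes that split the macro-element -/

section SplitConverse

variable {K : SimplicialComplex ℝ E3} {q : E3}

theorem isClosed_semiplane (q : E3) {w : ℂ} (hw : w ≠ 0) : IsClosed (semiplane q w) := by
  have : semiplane q w = {x | planeDet w (horiz (x - q)) = 0 ∧
      0 ≤ (horiz (x - q)).re * w.re + (horiz (x - q)).im * w.im} := by
    have hpos : 0 < w.re * w.re + w.im * w.im := by
      have := Complex.normSq_pos.2 hw
      rwa [Complex.normSq_apply] at this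
    ext x
    simp only [semiplane, mem_ofPred_eq]
    constructor
    · rintro ⟨a, ha, h⟩
      rw [h]
      simp only [planeDet, Complex.real_smul, Complex.re_ofReal_mul, Complex.im_ofReal_mul]
      exact ⟨by ring, by nlinarith [mul_nonneg ha hpos.le]⟩
    · rintro ⟨h1, h2⟩
      refine ⟨_, div_nonneg h2 hpos.le, ?_⟩
      simp only [planeDet] at h1
      apply Complex.ext
      · simp only [Complex.real_smul, Complex.re_ofReal_mul]
        rw [div_mul_eq_mul_div, eq_div_iff hpos.ne']
        linear_combination (-w.im) * h1
      · simp only [Complex.real_smul, Complex.im_ofReal_mul]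
        rw [div_mul_eq_mul_div, eq_div_iff hpos.ne']
        linear_combination w.re * h1
  rw [this]
  have hc : Continuous fun x : E3 => horiz (x - q) := by fun_prop
  rw [ofPred_and]
  refine IsClosed.inter (isClosed_eq ?_ continuous_const) (isClosed_le continuous_const ?_)
  · unfold planeDet; fun_prop
  · fun_prop

theorem planeDet_I_mul (w : ℂ) : planeDet w (Complex.I * w) = Complex.normSq w := by
  simp [planeDet, Complex.normSq_apply]

theorem planeDet_add (u v w : ℂ) : planeDet u (v + w) = planeDet u v + planeDet u w := by
  simp [planeDet]; ring

theorem planeDet_smul (u v : ℂ) (a : ℝ) : planeDet u (a • v) = a * planeDet u v := by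
  simp only [planeDet, Complex.real_smul, Complex.re_ofReal_mul, Complex.im_ofReal_mul]; ring

theorem planeDet_self (u : ℂ) : planeDet u u = 0 := by simp [planeDet]; ring

/-- A semi-plane that takes part in a splitting by at least two semi-planes is contained in the
skeleton of the mesh. Otherwise some element would join the two sides of the semi-plane; each side
belongs to a single macro-element near a segment that runs within the semi-plane from this element
to a point where two macro-elements are separated by this semi-plane alone, a contradiction. -/
theorem inSkeleton_of_isSplitBy (h : IsInteriorVertex K q) {S : Finset (Set E3)}
    (hS : (S : Set (Set E3)) ⊆ semiplaneFamily q) (hsplit : IsSplitBy K (vertexMacro K q) S)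
    (hcard : 2 ≤ S.card) {w : ℂ} (hw0 : w ≠ 0) (hw : semiplane q w ∈ S) : InSkeleton K q w := by
  classical
  obtain ⟨m, N, -, hN, hunion, hinter, hneed⟩ := hsplit
  choose A hAmesh _ hNA using fun i => (hN i).2
  have hNM : ∀ i, N i ⊆ vertexMacro K q := fun i => hunion ▸ subset_iUnion N i
  have hA : ∀ i, A i ⊆ vertexStar K q := fun i s hs => by
    refine mem_vertexStar_of_subset (hAmesh i hs) (Subset.trans ?_ (hNM i))
    rw [hNA i]
    exact subset_biUnion_of_mem (u := fun s : Finset E3 => convexHull ℝ (s : Set E3)) hs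
  have hNmem : ∀ i x, x ∈ N i ↔ ∃ s ∈ A i, x ∈ convexHull ℝ (s : Set E3) := fun i x => by
    rw [hNA i]; simp [region]
  have hNclosed : ∀ i, IsClosed (N i) := fun i => hNA i ▸ isClosed_region h (hA i)
  have hNstar : ∀ i x (t : ℝ), x ∈ N i → 0 ≤ t → t ≤ 1 → q + t • (x - q) ∈ N i := by
    intro i x t hx h0 h1
    obtain ⟨s, hs, hxs⟩ := (hNmem i x).1 hx
    exact (hNmem i _).2 ⟨s, hs, homothety_mem (hA i hs) hxs h0 h1⟩
  -- the other semi-planes avoid the points strictly inside the given one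
  set C : Set E3 := ⋃₀ ((S : Set (Set E3)) \ {semiplane q w}) with hC
  have hCclosed : IsClosed C := by
    rw [hC, sUnion_eq_biUnion]
    refine (S.finite_toSet.sdiff).isClosed_biUnion fun P hP => ?_
    obtain ⟨v, hv, rfl⟩ := mem_semiplaneFamily_iff.1 (hS hP.1)
    exact isClosed_semiplane q hv
  have hCoff : ∀ z (c : ℝ), 0 < c → horiz (z - q) = c • w → z ∉ C := by
    rintro z c hc hz ⟨P, ⟨hP, hPw⟩, hzP⟩
    obtain ⟨v, hv, rfl⟩ := mem_semiplaneFamily_iff.1 (hS hP)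
    obtain ⟨b, hb, hzb⟩ := hzP
    rw [hz] at hzb
    refine ray_ne_of_semiplane_ne hw0 (Ne.symm hPw) (c⁻¹ * b) (by positivity) ?_
    rw [← smul_smul, ← hzb, smul_smul, inv_mul_cancel₀ hc.ne', one_smul]
  obtain ⟨i, j, hij, hnot⟩ := hneed _ hw
  obtain ⟨x, ⟨hxi, hxj⟩, hxC⟩ := not_subset.1 hnot
  have hxP : x ∈ semiplane q w := by
    obtain ⟨P, hP, hxP⟩ := hinter i j hij ⟨hxi, hxj⟩
    by_cases hPw : P = semiplane q w
    · exact hPw ▸ hxP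
    · exact absurd ⟨P, ⟨hP, hPw⟩, hxP⟩ hxC
  obtain ⟨a, ha, hxa⟩ := hxP
  have ha : 0 < a := by
    refine lt_of_le_of_ne ha ?_
    rintro rfl
    obtain ⟨P, hP, hPw⟩ := Finset.exists_mem_ne (by omega : 1 < S.card) (semiplane q w)
    obtain ⟨v, hv, rfl⟩ := mem_semiplaneFamily_iff.1 (hS hP)
    exact hxC ⟨_, ⟨hP, hPw⟩, axis_mem_semiplane v (by simpa using hxa)⟩
  intro s hs
  rw [Set.disjoint_left]
  rintro y₀ hy₀ ⟨b₀, hb₀, hyb₀⟩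
  -- a point of the interior of `s`, strictly inside the semi-plane
  obtain ⟨ε, hε, hε0⟩ := (((tendsto_add_smul y₀ (lift w)).eventually
    (isOpen_interior.mem_nhds hy₀)).and self_mem_nhdsWithin).exists
  have hε0 : 0 < ε := hε0
  set y := y₀ + ε • lift w with hy
  have hyb : horiz (y - q) = (b₀ + ε) • w := by
    rw [hy, add_sub_right_comm, map_add, hyb₀, map_smul, horiz_lift, add_smul]
  -- contraction towards `q`
  obtain ⟨r, hr, hball⟩ := Metric.mem_nhds_iff.1
    (isOpen_interior.mem_nhds (mem_interior_iff_mem_nhds.2 h.mem_nhds))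
  obtain ⟨t, ⟨⟨ht1, ht2⟩, ht3⟩, ht0⟩ := (((tendsto_add_smul q (x - q)).eventually
    (Metric.ball_mem_nhds q hr)).and ((tendsto_add_smul q (y - q)).eventually
    (Metric.ball_mem_nhds q hr)) |>.and
    (nhdsWithin_le_nhds (Iio_mem_nhds (show (0 : ℝ) < 1 by norm_num)))
    |>.and self_mem_nhdsWithin).exists
  have ht0 : 0 < t := ht0
  have ht3 : t ≤ 1 := le_of_lt ht3
  set X := q + t • (x - q) with hX
  set Y := q + t • (y - q) with hY
  have hXa : horiz (X - q) = (t * a) • w := by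
    rw [hX, add_sub_cancel_left, map_smul, hxa, smul_smul]
  have hYb : horiz (Y - q) = (t * (b₀ + ε)) • w := by
    rw [hY, add_sub_cancel_left, map_smul, hyb, smul_smul]
  have hYs : Y ∈ interior (convexHull ℝ (s : Set E3)) := homothety_mem_interior hs hε ht0 ht3
  have hseg : segment ℝ X Y ⊆ interior (vertexMacro K q) ∩ Cᶜ := by
    intro z hz
    refine ⟨hball ((convex_ball q r).segment_subset ht1 ht2 hz), ?_⟩
    obtain ⟨α, β, hα, hβ, hαβ, rfl⟩ := hz
    refine hCoff _ (α * (t * a) + β * (t * (b₀ + ε))) ?_ ?_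
    · have h1 : 0 < t * a := by positivity
      have h2 : 0 < t * (b₀ + ε) := by positivity
      rcases hα.eq_or_lt with rfl | hα
      · rw [zero_add] at hαβ; subst hαβ; linarith
      · have := mul_pos hα h1
        have := mul_nonneg hβ h2.le
        linarith
    · have : α • X + β • Y - q = α • (X - q) + β • (Y - q) := by
        have : q = (α + β) • q := by rw [hαβ, one_smul]
        nth_rewrite 1 [this]
        rw [smul_sub, smul_sub, add_smul]; abel
      rw [this, map_add, map_smul, map_smul, hXa, hYb, add_smul, smul_smul, smul_smul]
  obtain ⟨δ, hδ, hthick⟩ := IsCompact.exists_thickening_subset_open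
    (convexHull_pair (𝕜 := ℝ) X Y ▸ (toFinite {X, Y}).isCompact_convexHull ℝ)
    (isOpen_interior.inter hCclosed.isOpen_compl) hseg
  set T := Metric.thickening δ (segment ℝ X Y) with hT
  have hTopen : IsOpen T := Metric.isOpen_thickening
  have hTconv : Convex ℝ T := (convex_segment X Y).thickening δ
  have hXT : X ∈ T := Metric.self_subset_thickening hδ _ (left_mem_segment ℝ X Y)
  have hYT : Y ∈ T := Metric.self_subset_thickening hδ _ (right_mem_segment ℝ X Y)
  let g : E3 → ℝ := fun z => planeDet w (horiz (z - q))
  have hg : ∀ z (c : ℝ), g (z + c • lift (Complex.I * w)) = g z + c * Complex.normSq w := by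
    intro z c
    simp only [g]
    rw [add_sub_right_comm, map_add, map_smul, horiz_lift, planeDet_add, planeDet_smul,
      planeDet_I_mul]
  have hw2 : 0 < Complex.normSq w := Complex.normSq_pos.2 hw0
  have hgP : ∀ z ∈ semiplane q w, g z = 0 := by
    rintro z ⟨c, -, hc⟩
    simp only [g, hc, planeDet_smul, planeDet_self, mul_zero]
  have hoff : ∀ z ∈ T, g z ≠ 0 → z ∉ ⋃₀ (S : Set (Set E3)) := by
    rintro z hz hgz ⟨P, hP, hzP⟩
    by_cases hPw : P = semiplane q w
    · exact hgz (hgP z (hPw ▸ hzP))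
    · exact (hthick hz).2 ⟨P, ⟨hP, hPw⟩, hzP⟩
  -- the macro-element that contains `s`
  obtain ⟨k, hk⟩ : ∃ k, Y ∈ N k := by
    have : Y ∈ ⋃ i, N i := by
      rw [hunion]; exact element_subset_vertexMacro hs (interior_subset hYs)
    exact mem_iUnion.1 this
  have hsk : convexHull ℝ (s : Set E3) ⊆ N k := by
    obtain ⟨s', hs', hYs'⟩ := (hNmem k Y).1 hk
    have := subset_of_mem_interior hs.1 (hA k hs').1 hYs hYs'
    subst this
    exact fun z hz => (hNmem k z).2 ⟨s, hs', hz⟩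
  have hside : ∀ σ : ℝ, σ ≠ 0 → T ∩ {z | 0 < σ * g z} ⊆ N k := by
    intro σ hσ
    have hconv : Convex ℝ (T ∩ {z | 0 < σ * g z}) := by
      refine hTconv.inter ?_
      intro z hz z' hz' α β hα hβ hαβ
      have hgl : g (α • z + β • z') = α * g z + β * g z' := by
        have : α • z + β • z' - q = α • (z - q) + β • (z' - q) := by
          have : q = (α + β) • q := by rw [hαβ, one_smul]
          nth_rewrite 1 [this]
          rw [smul_sub, smul_sub, add_smul]; abel
        simp only [g]
        rw [this, map_add, map_smul, map_smul, planeDet_add, planeDet_smul, planeDet_smul]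
      have hz : 0 < σ * g z := hz
      have hz' : 0 < σ * g z' := hz'
      change 0 < σ * g (α • z + β • z')
      rw [hgl]
      have : σ * (α * g z + β * g z') = α * (σ * g z) + β * (σ * g z') := by ring
      rw [this]
      rcases hα.eq_or_lt with rfl | hα
      · rw [zero_add] at hαβ; subst hαβ; linarith
      · have := mul_pos hα hz
        have := mul_nonneg hβ hz'.le
        linarith
    have hsub : T ∩ {z | 0 < σ * g z} ⊆ N k ∪ ⋃ l ∈ ({k}ᶜ : Set (Fin m)), N l := by
      intro z hz
      have hzM : z ∈ ⋃ i, N i := by rw [hunion]; exact interior_subset (hthick hz.1).1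
      obtain ⟨l, hl⟩ := mem_iUnion.1 hzM
      by_cases hlk : l = k
      · exact Or.inl (hlk ▸ hl)
      · exact Or.inr (mem_biUnion (show l ∈ ({k}ᶜ : Set (Fin m)) from hlk) hl)
    have hdisj : ∀ z ∈ T ∩ {z | 0 < σ * g z}, z ∈ N k → z ∉ ⋃ l ∈ ({k}ᶜ : Set (Fin m)), N l := by
      intro z hz hzk hzl
      obtain ⟨l, hlk, hzl⟩ := mem_iUnion₂.1 hzl
      refine hoff z hz.1 ?_ (hinter l k hlk ⟨hzl, hzk⟩)
      intro h0
      have : 0 < σ * g z := hz.2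
      simp [h0] at this
    have hcl : IsClosed (⋃ l ∈ ({k}ᶜ : Set (Fin m)), N l) :=
      (toFinite _).isClosed_biUnion fun l _ => hNclosed l
    rcases isPreconnected_iff_subset_of_disjoint_closed.1 hconv.isPreconnected _ _ (hNclosed k) hcl
      hsub (eq_empty_of_forall_notMem fun z hz => hdisj z hz.1 hz.2.1 hz.2.2) with hres | hres
    · exact hres
    · obtain ⟨η, ⟨h1, h2⟩, h3⟩ := (((tendsto_add_smul Y (σ • lift (Complex.I * w))).eventually
        (hTopen.mem_nhds hYT)).and ((tendsto_add_smul Y (σ • lift (Complex.I * w))).eventually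
        (isOpen_interior.mem_nhds hYs)) |>.and self_mem_nhdsWithin).exists
      have h3 : 0 < η := h3
      have hmem : Y + η • σ • lift (Complex.I * w) ∈ T ∩ {z | 0 < σ * g z} := by
        refine ⟨h1, ?_⟩
        have hY0 : g Y = 0 := hgP Y ⟨_, by positivity, hYb⟩
        change 0 < σ * g _
        rw [smul_smul, hg, hY0]
        have : σ * (0 + η * σ * Complex.normSq w) = η * (σ ^ 2 * Complex.normSq w) := by ring
        rw [this]
        have := pow_pos (abs_pos.2 hσ) 2
        rw [sq_abs] at this
        positivity
      exact absurd (hres hmem) (hdisj _ hmem (hsk (interior_subset h2)))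
  -- both sides of the semi-plane belong to `N k`, so no other macro-element reaches `X`
  have honly : ∀ l, X ∈ N l → l = k := by
    intro l hXl
    obtain ⟨s', hs', hXs'⟩ := (hNmem l X).1 hXl
    obtain ⟨z₀, hz₀T, hz₀⟩ := mem_closure_iff.1
      (element_subset_closure_interior (hA l hs').1 hXs') T hTopen hXT
    obtain ⟨z, hzT, hz, hgz⟩ : ∃ z ∈ T, z ∈ interior (convexHull ℝ (s' : Set E3)) ∧ g z ≠ 0 := by
      by_cases hg0 : g z₀ = 0
      · obtain ⟨η, ⟨h1, h2⟩, h3⟩ := (((tendsto_add_smul z₀ (lift (Complex.I * w))).eventually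
          (hTopen.mem_nhds hz₀T)).and ((tendsto_add_smul z₀ (lift (Complex.I * w))).eventually
          (isOpen_interior.mem_nhds hz₀)) |>.and self_mem_nhdsWithin).exists
        have h3 : 0 < η := h3
        refine ⟨_, h1, h2, ?_⟩
        rw [hg, hg0, zero_add]
        positivity
      · exact ⟨z₀, hz₀T, hz₀, hg0⟩
    by_contra hlk
    have hzk : z ∈ N k := hside (g z) hgz ⟨hzT, mul_self_pos.2 hgz⟩
    have hzl : z ∈ N l := (hNmem l z).2 ⟨s', hs', interior_subset hz⟩
    exact hoff z hzT hgz (hinter l k hlk ⟨hzl, hzk⟩)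
  exact hij ((honly i (hNstar i x t hxi ht0.le ht3)).trans
    (honly j (hNstar j x t hxj ht0.le ht3)).symm)

end SplitConverse

/-! ### Piecewise linear functions on the plane with creases along given rays -/

/-- The function `∑ c d * det (d, u) * angle (d, u)`. If `∑ c d • d = 0`, it is continuous and
linear in each sector between the rays of `D`: there the angles differ by constants from a common
angle, whose coefficient is `det (∑ c d • d, u)`. Across the ray of `d` its gradient jumps by a
multiple of `c d`. -/
noncomputable def creaseFun (D : Finset ℂ) (c : ℂ → ℝ) (u : ℂ) : ℝ :=
  ∑ d ∈ D, c d * (planeDet d u * angleFrom d u)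

/-- The determinant with a fixed first entry, as a linear map. -/
noncomputable def planeDetLin (d : ℂ) : ℂ →ₗ[ℝ] ℝ where
  toFun := planeDet d
  map_add' := planeDet_add d
  map_smul' a v := by simp [planeDet_smul, -Complex.real_smul]

theorem continuous_planeDet (d : ℂ) : Continuous (planeDet d) :=
  LinearMap.continuous_of_finiteDimensional (planeDetLin d)

theorem continuous_planeDet_mul_angleFrom {d : ℂ} (hd : d ≠ 0) :
    Continuous fun u => planeDet d u * angleFrom d u := by
  rw [continuous_iff_continuousAt]
  intro u
  by_cases h : ∀ a : ℝ, 0 ≤ a → u ≠ a • d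
  · exact (continuous_planeDet d).continuousAt.mul (continuousAt_angleFrom hd h)
  · -- on the ray of `d` the angle jumps, but the determinant vanishes
    push Not at h
    obtain ⟨a, -, rfl⟩ := h
    have h0 : planeDet d (a • d) = 0 := by rw [planeDet_smul, planeDet_self, mul_zero]
    rw [ContinuousAt, h0, zero_mul]
    have hlim : Filter.Tendsto (fun u => |planeDet d u| * Real.pi) (nhds (a • d)) (nhds 0) := by
      have h1 : Continuous fun u => |planeDet d u| * Real.pi :=
        (continuous_planeDet d).abs.mul continuous_const
      have := h1.tendsto (a • d)
      rwa [h0, abs_zero, zero_mul] at this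
    refine squeeze_zero_norm (fun u => ?_) hlim
    rw [Real.norm_eq_abs, abs_mul]
    exact mul_le_mul_of_nonneg_left (Complex.abs_arg_le_pi _) (abs_nonneg _)

theorem continuous_creaseFun {D : Finset ℂ} (hD : ∀ d ∈ D, d ≠ 0) (c : ℂ → ℝ) :
    Continuous (creaseFun D c) :=
  continuous_finsetSum _ fun d hd =>
    continuous_const.mul (continuous_planeDet_mul_angleFrom (hD d hd))

/-- Near a point off the rays, the function is the sum of a linear function and a multiple of the
angle measured from that point. -/
theorem creaseFun_eventually_eq {D : Finset ℂ} (hD : ∀ d ∈ D, d ≠ 0) (c : ℂ → ℝ) {u₀ : ℂ}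
    (hu₀ : u₀ ≠ 0) (hoff : ∀ d ∈ D, ∀ a : ℝ, 0 ≤ a → u₀ ≠ a • d) :
    ∃ L : ℂ →ₗ[ℝ] ℝ, ∀ᶠ u in nhds u₀, creaseFun D c u =
      L u + Complex.arg (u / u₀) * planeDet (∑ d ∈ D, c d • d) u := by
  have hang : ∀ d ∈ D, ∀ᶠ u in nhds u₀,
      angleFrom d u = angleFrom d u₀ + Complex.arg (u / u₀) := by
    intro d hd
    have hsl := neg_div_mem_slitPlane (hD d hd) (hoff d hd)
    have hne := Complex.mem_slitPlane_iff_arg.1 hsl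
    have h1 : ContinuousAt (fun u : ℂ => Complex.arg (u / u₀)) u₀ := by
      have h2 : ContinuousAt (fun u : ℂ => u / u₀) u₀ := by fun_prop
      refine ContinuousAt.comp (f := fun u : ℂ => u / u₀) (x := u₀)
        (Complex.continuousAt_arg ?_) h2
      simp [div_self hu₀]
    have h2 : ContinuousAt (fun u : ℂ => angleFrom d u₀ + Complex.arg (u / u₀)) u₀ :=
      continuousAt_const.add h1
    have h3 : angleFrom d u₀ + Complex.arg (u₀ / u₀) ∈ Ioo (-Real.pi) Real.pi := by
      rw [div_self hu₀, Complex.arg_one, add_zero]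
      exact ⟨Complex.neg_pi_lt_arg _, lt_of_le_of_ne (Complex.arg_le_pi _) hne.1⟩
    filter_upwards [h2.eventually (isOpen_Ioo.mem_nhds h3), isOpen_ne.mem_nhds hu₀] with u hu hu0
    have hu0 : u ≠ 0 := hu0
    have e : -(u / d) = -(u₀ / d) * (u / u₀) := by
      have := hD d hd
      field_simp
    rw [angleFrom, e]
    exact Complex.arg_mul_eq_add_arg_iff hne.2 (div_ne_zero hu0 hu₀) |>.2 (Ioo_subset_Ioc_self hu)
  refine ⟨∑ d ∈ D, (c d * angleFrom d u₀) • planeDetLin d, ?_⟩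
  filter_upwards [(Filter.eventually_all_finset D).2 hang] with u hu
  have hdet : planeDet (∑ d ∈ D, c d • d) u = ∑ d ∈ D, c d * planeDet d u := by
    have hrefl : ∀ v w, planeDet v w = -planeDetLin w v := fun v w => by
      simp only [planeDetLin, LinearMap.coe_mk, AddHom.coe_mk, planeDet]; ring
    rw [hrefl, map_sum, ← Finset.sum_neg_distrib]
    refine Finset.sum_congr rfl fun d _ => ?_
    rw [map_smul, hrefl, smul_eq_mul, mul_neg]
  rw [hdet, creaseFun, Finset.mul_sum, LinearMap.sum_apply, ← Finset.sum_add_distrib]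
  refine Finset.sum_congr rfl fun d hd => ?_
  rw [hu d hd]
  simp only [LinearMap.smul_apply, smul_eq_mul, planeDetLin, LinearMap.coe_mk, AddHom.coe_mk]
  ring

/-- The function has a crease along each ray with nonzero coefficient: near the ray of `d` it is
the sum of a linear function and a nonzero multiple of `|det (d, u)|`. -/
theorem creaseFun_eventually_eq_abs {D : Finset ℂ} (hD : ∀ d ∈ D, d ≠ 0) {c : ℂ → ℝ}
    (hrel : ∑ d ∈ D, c d • d = 0) {d : ℂ} (hd : d ∈ D)
    (hray : ∀ e ∈ D, e ≠ d → ∀ a : ℝ, 0 ≤ a → d ≠ a • e) {ε : ℝ} (hε : 0 < ε) :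
    ∃ L : ℂ →ₗ[ℝ] ℝ, ∀ᶠ u in nhds (ε • d),
      creaseFun D c u = L u - c d * Real.pi * |planeDet d u| := by
  classical
  have hd0 := hD d hd
  have hu₀ : ε • d ≠ 0 := smul_ne_zero hε.ne' hd0
  obtain ⟨L, hL⟩ := creaseFun_eventually_eq (D := D.erase d) (u₀ := ε • d)
    (fun e he => hD e (Finset.mem_of_mem_erase he)) c hu₀ (fun e he a ha h => by
      refine hray e (Finset.mem_of_mem_erase he) (Finset.ne_of_mem_erase he) (ε⁻¹ * a)
        (by positivity) ?_
      rw [← smul_smul, ← h, smul_smul, inv_mul_cancel₀ hε.ne', one_smul])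
  refine ⟨L, ?_⟩
  filter_upwards [hL] with u hu
  have hsplit : creaseFun D c u =
      c d * (planeDet d u * angleFrom d u) + creaseFun (D.erase d) c u := by
    exact (Finset.add_sum_erase D (fun e => c e * (planeDet e u * angleFrom e u)) hd).symm
  have hsum : ∑ e ∈ D.erase d, c e • e = (-c d) • d := by
    have := Finset.add_sum_erase D (fun e => c e • e) hd
    rw [hrel] at this
    rw [neg_smul, eq_neg_iff_add_eq_zero, add_comm]
    exact this
  have hdet : planeDet ((-c d) • d) u = -c d * planeDet d u := by
    simp only [planeDet, Complex.real_smul, Complex.re_ofReal_mul, Complex.im_ofReal_mul]; ring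
  set z := u / (ε • d) with hz
  have hang : angleFrom d u = Complex.arg (-z) := by
    rw [angleFrom, hz, ← Complex.arg_real_mul (-(u / (ε • d))) hε]
    congr 1
    rw [Complex.real_smul]
    have : (ε : ℂ) ≠ 0 := by exact_mod_cast hε.ne'
    field_simp
  -- the determinant has the sign of the imaginary part of `u / (ε • d)`
  have hdz : planeDet d u = ε * Complex.normSq d * z.im := by
    have : u = z * (ε • d) := by rw [hz, div_mul_cancel₀ _ hu₀]
    conv_lhs => rw [this]
    simp only [planeDet, Complex.real_smul, Complex.mul_re, Complex.mul_im, Complex.ofReal_re,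
      Complex.ofReal_im, Complex.normSq_apply]
    ring
  have hpos : 0 < ε * Complex.normSq d := mul_pos hε (Complex.normSq_pos.2 hd0)
  rw [hsplit, hu, hsum, hdet, hang]
  rcases lt_trichotomy z.im 0 with him | him | him
  · rw [Complex.arg_neg_eq_arg_add_pi_of_im_neg him,
      abs_of_neg (hdz ▸ mul_neg_of_pos_of_neg hpos him)]
    ring
  · rw [him, mul_zero] at hdz
    rw [hdz]; simp
  · rw [Complex.arg_neg_eq_arg_sub_pi_of_im_pos him, abs_of_pos (hdz ▸ mul_pos hpos him)]
    ring

/-! ### Pressures in the kernel -/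

section NonRegular

variable {K : SimplicialComplex ℝ E3} {q : E3} {p : E3 → ℝ} {s : Finset E3}

/-- A pressure that is not affine and does not depend on the vertical coordinate yields, after
subtraction of a suitable horizontal linear function, a nonconstant element of the kernel. -/
theorem not_isRegular_of_pressure (h : IsInteriorVertex K q)
    (hp : MemPressure K (vertexMacro K q) p) (hz : ∀ x (t : ℝ), p (x + t • axis 2) = p x)
    (hna : ¬ ∃ f : E3 →ᵃ[ℝ] ℝ, EqOn p f (vertexMacro K q)) :
    ¬ IsRegularP1P1P1bP1 K (vertexMacro K q) := by
  intro hreg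
  set J : Fin 3 → ℝ := fun i => ∫ x in vertexMacro K q, lineDeriv ℝ p x (axis i) * hat K q x
  set H : ℝ := ∫ x in vertexMacro K q, hat K q x with hH
  have hH0 : H ≠ 0 := (integral_hat_pos h).ne'
  -- the mean values of the horizontal derivatives, weighted with the hat function
  let ℓ : E3 →ᵃ[ℝ] ℝ := (((J 0 / H) • (EuclideanSpace.proj (0 : Fin 3) : E3 →L[ℝ] ℝ) +
    (J 1 / H) • (EuclideanSpace.proj (1 : Fin 3) : E3 →L[ℝ] ℝ) :
    E3 →L[ℝ] ℝ)).toLinearMap.toAffineMap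
  have hℓ : ∀ x, ℓ x = J 0 / H * x 0 + J 1 / H * x 1 := fun x => by simp [ℓ]
  have hℓ0 : ℓ.linear (axis 0) = J 0 / H := by simp [ℓ, axis]
  have hℓ1 : ℓ.linear (axis 1) = J 1 / H := by simp [ℓ, axis]
  have hp' : MemPressure K (vertexMacro K q) (fun x => p x - ℓ x) := by
    refine ⟨hp.1.sub (affineMap_continuous ℓ).continuousOn, fun s hs hsub => ?_⟩
    obtain ⟨f, hf⟩ := hp.2 s hs hsub
    exact ⟨f - ℓ, fun x hx => by simp [hf x hx]⟩
  have hder : ∀ s ∈ vertexStar K q, ∀ x ∈ interior (convexHull ℝ (s : Set E3)), ∀ v,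
      lineDeriv ℝ (fun x => p x - ℓ x) x v = lineDeriv ℝ p x v - ℓ.linear v := by
    intro s hs x hx v
    obtain ⟨f, hf⟩ := hp.isP1On hs
    rw [lineDeriv_of_eqOn (f := f) hf hx, lineDeriv_of_eqOn (f := f - ℓ) _ hx]
    · simp
    · intro y hy
      simp [hf y hy]
  have hint : ∀ i, ℓ.linear (axis i) = J i / H →
      ∫ x in vertexMacro K q, lineDeriv ℝ (fun x => p x - ℓ x) x (axis i) * hat K q x = 0 := by
    intro i hi
    have : ∫ x in vertexMacro K q, lineDeriv ℝ (fun x => p x - ℓ x) x (axis i) * hat K q x =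
        ∫ x in vertexMacro K q,
          (lineDeriv ℝ p x (axis i) * hat K q x - J i / H * hat K q x) := by
      refine setIntegral_congr_ae (isClosed_vertexMacro h).measurableSet ?_
      filter_upwards [ae_exists_mem_interior h.finite] with x hx hxM
      obtain ⟨s, hs, hxs⟩ := hx hxM
      rw [hder s hs x hxs, hi]; ring
    rw [this, integral_sub
      ((hp.piecewiseC1.lineDeriv _).mul piecewiseC1_hat.piecewiseCont |>.integrableOn h.finite)
      ((piecewiseC1_hat.piecewiseCont.integrableOn h.finite).const_mul _), integral_const_mul]
    change J i - J i / H * H = 0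
    rw [div_mul_cancel₀ _ hH0, sub_self]
  have hker := memKernel_of_integral_eq_zero h hp' (fun s hs x _ => by
    have : (fun t : ℝ => p (x + t • axis 2) - ℓ (x + t • axis 2)) = fun _ => p x - ℓ x := by
      ext t
      rw [hz, hℓ, hℓ]
      simp [axis]
    rw [lineDeriv, this, deriv_const]) (hint 0 hℓ0) (hint 1 hℓ1)
  obtain ⟨b, hb⟩ := hreg _ hker
  refine hna ⟨ℓ + AffineMap.const ℝ E3 b, fun x hx => ?_⟩
  have := hb x hx
  simp only [AffineMap.coe_add, Pi.add_apply, AffineMap.const_apply]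
  linarith

/-- If the directions of some semi-planes within the skeleton are linearly dependent, then the
combination is not regular. -/
theorem IsSkeletonFan.not_isRegular {D : Finset ℂ} (h : IsInteriorVertex K q)
    (hD : IsSkeletonFan K q D) {c : ℂ → ℝ} (hrel : ∑ d ∈ D, c d • d = 0)
    (hc : ∃ d ∈ D, c d ≠ 0) : ¬ IsRegularP1P1P1bP1 K (vertexMacro K q) := by
  obtain ⟨d, hd, hcd⟩ := hc
  have hd0 := hD.ne_zero d hd
  have hcont : Continuous fun x : E3 => creaseFun D c (horiz (x - q)) := by
    have := continuous_creaseFun hD.ne_zero c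
    fun_prop
  refine not_isRegular_of_pressure h (p := fun x => creaseFun D c (horiz (x - q)))
    ⟨hcont.continuousOn, fun s hs hsub => ?_⟩ (fun x t => ?_) ?_
  · -- the function is linear on the projection of each element
    have hs := mem_vertexStar_of_subset hs hsub
    have hproj : Continuous fun x : E3 => horiz (x - q) := by fun_prop
    obtain ⟨L, hL⟩ := exists_linearMap_of_isPreconnected (F := creaseFun D c)
      ((convex_convexHull ℝ (s : Set E3)).interior.isPreconnected.image _ hproj.continuousOn)
      (by
        rintro _ ⟨x, hx, rfl⟩
        have hoff : ∀ e ∈ D, x ∉ semiplane q e := fun e he hxe =>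
          Set.disjoint_left.1 (hD.inSkeleton e he s hs) hx hxe
        obtain ⟨L, hL⟩ := creaseFun_eventually_eq hD.ne_zero c
          (horiz_ne_zero_of_notMem (hoff d hd))
          (fun e he => horiz_ne_smul_of_notMem (hoff e he))
        refine ⟨L, ?_⟩
        filter_upwards [hL] with u hu
        rw [hu, hrel]
        simp [planeDet])
    let f : E3 →ᵃ[ℝ] ℝ :=
      (L.comp (horiz : E3 →ₗ[ℝ] ℂ)).toAffineMap + AffineMap.const ℝ E3 (-L (horiz q))
    have heq : EqOn (fun x => creaseFun D c (horiz (x - q))) f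
        (interior (convexHull ℝ (s : Set E3))) := by
      intro x hx
      simp only [hL _ (mem_image_of_mem _ hx)]
      simp [f, sub_eq_add_neg]
    exact ⟨f, (heq.closure hcont (affineMap_continuous f)).mono
      (element_subset_closure_interior hs.1)⟩
  · rw [add_sub_right_comm, map_add, map_smul, horiz_axis_two, smul_zero, add_zero]
  · rintro ⟨f, hf⟩
    -- the second difference across the ray of `d` does not vanish
    obtain ⟨ε, hεM, hε⟩ := ((eventually_add_smul_mem_interior h (lift d)).and
      self_mem_nhdsWithin).exists
    have hε : 0 < ε := hε
    obtain ⟨L, hL⟩ := creaseFun_eventually_eq_abs hD.ne_zero hrel hd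
      (fun e he hne => ray_ne_of_semiplane_ne hd0 (hD.injOn d hd e he hne.symm)) hε
    have hG : ∀ w : ℂ, q + lift w ∈ vertexMacro K q →
        creaseFun D c w = f q + f.linear (lift w) := by
      intro w hw
      have := hf hw
      simp only [add_sub_cancel_left, horiz_lift] at this
      rw [this, affineMap_eq_linear_add f _ q, add_sub_cancel_left]
    have hcl : ContinuousAt (fun w : ℂ => q + lift w) (ε • d) := by fun_prop
    have hev : ∀ᶠ w in nhds (ε • d), q + lift w ∈ vertexMacro K q := by
      have hmem : q + lift (ε • d) ∈ interior (vertexMacro K q) := by rwa [map_smul]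
      exact hcl.eventually (mem_interior_iff_mem_nhds.1 hmem)
    have hev2 : ∀ᶠ w in nhds (ε • d),
        f q + f.linear (lift w) = L w - c d * Real.pi * |planeDet d w| := by
      filter_upwards [hev, hL] with w h1 h2
      rw [← hG w h1, h2]
    obtain ⟨η, ⟨h1, h2⟩, hη⟩ := (((tendsto_add_smul (ε • d) (Complex.I * d)).eventually hev2).and
      ((tendsto_add_smul (ε • d) (-(Complex.I * d))).eventually hev2) |>.and
      self_mem_nhdsWithin).exists
    have hη : 0 < η := hη
    have h0 := hev2.self_of_nhds
    have hpos : 0 < Complex.normSq d := Complex.normSq_pos.2 hd0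
    have e0 : planeDet d (ε • d) = 0 := by rw [planeDet_smul, planeDet_self, mul_zero]
    have e1 : planeDet d (ε • d + η • (Complex.I * d)) = η * Complex.normSq d := by
      rw [planeDet_add, e0, planeDet_smul, planeDet_I_mul, zero_add]
    have e2 : planeDet d (ε • d + η • -(Complex.I * d)) = -(η * Complex.normSq d) := by
      rw [planeDet_add, e0, smul_neg, ← neg_smul, planeDet_smul, planeDet_I_mul]; ring
    rw [e0] at h0
    rw [e1, abs_of_pos (by positivity)] at h1
    rw [e2, abs_neg, abs_of_pos (by positivity)] at h2
    simp only [map_add, map_smul, map_neg, smul_eq_mul, abs_zero] at h0 h1 h2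
    have : c d * Real.pi * (η * Complex.normSq d) = 0 := by linarith
    have hpi := Real.pi_ne_zero
    exact absurd this (by positivity)

end NonRegular

/-! ### Regularity and splittings -/

section Main

variable {K : SimplicialComplex ℝ E3} {q : E3}

/-- If the combination is not regular, then for any two independent directions there is a
semi-plane within the skeleton that lies over a third direction. -/
theorem exists_inSkeleton_of_not_isRegular (h : IsInteriorVertex K q)
    (hreg : ¬ IsRegularP1P1P1bP1 K (vertexMacro K q)) {d₁ d₂ : ℂ} (hd : planeDet d₁ d₂ ≠ 0) :
    ∃ w : ℂ, w ≠ 0 ∧ InSkeleton K q w ∧ semiplane q w ≠ semiplane q d₁ ∧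
      semiplane q w ≠ semiplane q d₂ := by
  simp only [IsRegularP1P1P1bP1, not_forall] at hreg
  obtain ⟨p, hp, hconst⟩ := hreg
  obtain ⟨w, hw, hsk, h1, h2⟩ := hp.1.exists_inSkeleton h
    (fun s hs f hf => hp.linear_axis_two h hs hf)
    (fun ⟨f, hf⟩ => hconst (hp.const_of_affine h hf)) hd
  refine ⟨w, hw, hsk, fun heq => ?_, fun heq => ?_⟩
  · obtain ⟨a, ha, hwa⟩ := (semiplane_eq_iff hw).1 heq
    exact h1 a ha.le hwa
  · obtain ⟨a, ha, hwa⟩ := (semiplane_eq_iff hw).1 heq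
    exact h2 a ha.le hwa

theorem IsSkeletonFan.coe_image_subset [DecidableEq (Set E3)] {D : Finset ℂ}
    (hD : IsSkeletonFan K q D) :
    ((D.image (semiplane q) : Finset (Set E3)) : Set (Set E3)) ⊆ semiplaneFamily q := by
  intro P hP
  obtain ⟨d, hd, rfl⟩ := Finset.mem_image.1 (Finset.mem_coe.1 hP)
  exact mem_semiplaneFamily_iff.2 ⟨d, hD.ne_zero d hd, rfl⟩

theorem IsSkeletonFan.card_image [DecidableEq (Set E3)] {D : Finset ℂ}
    (hD : IsSkeletonFan K q D) : (D.image (semiplane q)).card = D.card :=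
  Finset.card_image_of_injOn fun d hd e he heq => by
    by_contra hne
    exact hD.injOn d hd e he hne heq

theorem IsSkeletonFan.insert [DecidableEq ℂ] {D : Finset ℂ} (hD : IsSkeletonFan K q D) {w : ℂ}
    (hw : w ≠ 0) (hsk : InSkeleton K q w) (hne : ∀ d ∈ D, semiplane q w ≠ semiplane q d) :
    IsSkeletonFan K q (insert w D) where
  ne_zero d hd := by
    rcases Finset.mem_insert.1 hd with rfl | hd
    exacts [hw, hD.ne_zero d hd]
  injOn d hd e he hde := by
    rcases Finset.mem_insert.1 hd with hd' | hd' <;> rcases Finset.mem_insert.1 he with he' | he'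
    · exact absurd (hd'.trans he'.symm) hde
    · exact hd' ▸ hne e he'
    · exact he' ▸ (hne d hd').symm
    · exact hD.injOn d hd' e he' hde
  inSkeleton d hd := by
    rcases Finset.mem_insert.1 hd with rfl | hd
    exacts [hsk, hD.inSkeleton d hd]

theorem isSkeletonFan_singleton {w : ℂ} (hw : w ≠ 0) (hsk : InSkeleton K q w) :
    IsSkeletonFan K q {w} where
  ne_zero d hd := by rwa [Finset.mem_singleton.1 hd]
  injOn d hd e he hde :=
    absurd ((Finset.mem_singleton.1 hd).trans (Finset.mem_singleton.1 he).symm) hde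
  inSkeleton d hd := by rwa [Finset.mem_singleton.1 hd]

/-- The semi-planes of a splitting form a fan within the skeleton. -/
theorem exists_isSkeletonFan_of_isSplitBy (h : IsInteriorVertex K q) {S : Finset (Set E3)}
    (hS : (S : Set (Set E3)) ⊆ semiplaneFamily q) (hsplit : IsSplitBy K (vertexMacro K q) S)
    (hcard : 2 ≤ S.card) : ∃ D : Finset ℂ, IsSkeletonFan K q D ∧ D.card = S.card := by
  classical
  choose! w hw0 hw using fun P (hP : P ∈ S) => mem_semiplaneFamily_iff.1 (hS hP)
  refine ⟨S.image w, ⟨fun d hd => ?_, fun d hd e he hde heq => ?_, fun d hd => ?_⟩, ?_⟩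
  · obtain ⟨P, hP, rfl⟩ := Finset.mem_image.1 hd
    exact hw0 P hP
  · obtain ⟨P, hP, rfl⟩ := Finset.mem_image.1 hd
    obtain ⟨Q, hQ, rfl⟩ := Finset.mem_image.1 he
    rw [← hw P hP, ← hw Q hQ] at heq
    exact hde (heq ▸ rfl)
  · obtain ⟨P, hP, rfl⟩ := Finset.mem_image.1 hd
    exact inSkeleton_of_isSplitBy h hS hsplit hcard (hw0 P hP) (hw P hP ▸ hP)
  · refine Finset.card_image_of_injOn fun P hP Q hQ heq => ?_
    rw [hw P hP, hw Q hQ, heq]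

/-- Three vectors of the plane are linearly dependent, so a splitting by three semi-planes or more
excludes regularity. -/
theorem IsSkeletonFan.not_isRegular_of_two_lt_card (h : IsInteriorVertex K q) {D : Finset ℂ}
    (hD : IsSkeletonFan K q D) (hcard : 2 < D.card) :
    ¬ IsRegularP1P1P1bP1 K (vertexMacro K q) := by
  obtain ⟨c, hrel, hc⟩ := Module.exists_nontrivial_relation_of_finrank_lt_card (R := ℝ) (t := D)
    (by rwa [Complex.finrank_real_complex])
  exact hD.not_isRegular h hrel hc

theorem mem_verticalPlane_iff {d : E3} (hd : IsHorizontal d) {x : E3} :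
    x ∈ verticalPlane q d ↔ ∃ a : ℝ, horiz (x - q) = a • horiz d := by
  constructor
  · rintro ⟨a, t, rfl⟩
    refine ⟨a, ?_⟩
    rw [add_assoc, add_sub_cancel_left, map_add, map_smul, map_smul]
    simp
  · rintro ⟨a, ha⟩
    refine ⟨a, (x - q) 2, ?_⟩
    have := lift_horiz_add (x - q)
    rw [ha, map_smul, hd.lift_horiz] at this
    rw [add_assoc, this]; abel

/-- Two distinct semi-planes are aligned if and only if their directions are dependent. -/
theorem areAligned_iff {d₁ d₂ : ℂ} (h₁ : d₁ ≠ 0) (h₂ : d₂ ≠ 0)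
    (hne : semiplane q d₁ ≠ semiplane q d₂) :
    AreAligned q (semiplane q d₁) (semiplane q d₂) ↔ planeDet d₁ d₂ = 0 := by
  constructor
  · rintro ⟨d, hd, hunion⟩
    have hm : ∀ w, q + lift w ∈ semiplane q w := fun w => ⟨1, zero_le_one, by simp⟩
    obtain ⟨a, ha⟩ := (mem_verticalPlane_iff hd).1 (hunion.subset (Or.inl (hm d₁)))
    obtain ⟨b, hb⟩ := (mem_verticalPlane_iff hd).1 (hunion.subset (Or.inr (hm d₂)))
    rw [add_sub_cancel_left, horiz_lift] at ha hb
    rw [ha, hb]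
    simp only [planeDet, Complex.real_smul, Complex.re_ofReal_mul, Complex.im_ofReal_mul]
    ring
  · intro hdet
    have hpos : 0 < Complex.normSq d₁ := Complex.normSq_pos.2 h₁
    -- the second direction is a multiple of the first one, by a negative factor
    obtain ⟨b, hb⟩ : ∃ b : ℝ, d₂ = b • d₁ := by
      refine ⟨(d₂.re * d₁.re + d₂.im * d₁.im) / Complex.normSq d₁, ?_⟩
      rw [Complex.normSq_apply] at hpos ⊢
      simp only [planeDet] at hdet
      apply Complex.ext
      · rw [Complex.real_smul, Complex.re_ofReal_mul, div_mul_eq_mul_div, eq_div_iff hpos.ne']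
        linear_combination (-d₁.im) * hdet
      · rw [Complex.real_smul, Complex.im_ofReal_mul, div_mul_eq_mul_div, eq_div_iff hpos.ne']
        linear_combination d₁.re * hdet
    have hb0 : b < 0 := by
      by_contra hb0
      rcases (not_lt.1 hb0).eq_or_lt with rfl | hb0
      · exact h₂ (by simpa using hb)
      · exact hne ((semiplane_eq_iff h₂).2 ⟨b, hb0, hb⟩).symm
    refine ⟨lift d₁, isHorizontal_lift h₁, ?_⟩
    ext x
    rw [mem_verticalPlane_iff (isHorizontal_lift h₁), horiz_lift]
    constructor
    · rintro (⟨a, -, ha⟩ | ⟨a, -, ha⟩)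
      · exact ⟨a, ha⟩
      · exact ⟨a * b, by rw [ha, hb, smul_smul]⟩
    · rintro ⟨a, ha⟩
      rcases le_total 0 a with ha0 | ha0
      · exact Or.inl ⟨a, ha0, ha⟩
      · refine Or.inr ⟨a / b, div_nonneg_of_nonpos ha0 hb0.le, ?_⟩
        rw [ha, hb, smul_smul, div_mul_cancel₀ _ hb0.ne]

theorem isRegular_of_not_isSplitBy (h : IsInteriorVertex K q)
    (hns : ∀ S : Finset (Set E3), (S : Set (Set E3)) ⊆ semiplaneFamily q →
      ¬ IsSplitBy K (vertexMacro K q) S) : IsRegularP1P1P1bP1 K (vertexMacro K q) := by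
  classical
  by_contra hreg
  obtain ⟨v, hv, hvs, -, -⟩ := exists_inSkeleton_of_not_isRegular h hreg
    (d₁ := 1) (d₂ := Complex.I) (by simp [planeDet])
  obtain ⟨w, hw, hws, hwv, -⟩ := exists_inSkeleton_of_not_isRegular h hreg
    (d₁ := v) (d₂ := Complex.I * v) (by
      rw [planeDet_I_mul]; exact (Complex.normSq_pos.2 hv).ne')
  have hD := (isSkeletonFan_singleton hv hvs).insert hw hws (by simpa using hwv)
  have hwv' : w ≠ v := fun heq => hwv (heq ▸ rfl)
  exact hns _ hD.coe_image_subset (hD.isSplitBy h (by rw [Finset.card_pair hwv']))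

theorem isRegular_iff_not_areAligned (h : IsInteriorVertex K q) {P Q : Set E3} (hPQ : P ≠ Q)
    {S : Finset (Set E3)} (hSPQ : (S : Set (Set E3)) = {P, Q})
    (hS : (S : Set (Set E3)) ⊆ semiplaneFamily q) (hsplit : IsSplitBy K (vertexMacro K q) S)
    (hmax : ∀ S' : Finset (Set E3), (S' : Set (Set E3)) ⊆ semiplaneFamily q →
      IsSplitBy K (vertexMacro K q) S' → S'.card ≤ 2) :
    IsRegularP1P1P1bP1 K (vertexMacro K q) ↔ ¬ AreAligned q P Q := by
  classical
  have hPS : P ∈ S := by rw [← Finset.mem_coe, hSPQ]; simp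
  have hQS : Q ∈ S := by rw [← Finset.mem_coe, hSPQ]; simp
  have hcard : 2 ≤ S.card := by
    have : ({P, Q} : Finset (Set E3)) ⊆ S := by
      intro R hR
      rcases Finset.mem_insert.1 hR with rfl | hR
      exacts [hPS, Finset.mem_singleton.1 hR ▸ hQS]
    simpa [Finset.card_pair hPQ] using Finset.card_le_card this
  obtain ⟨d₁, h₁, rfl⟩ := mem_semiplaneFamily_iff.1 (hS hPS)
  obtain ⟨d₂, h₂, rfl⟩ := mem_semiplaneFamily_iff.1 (hS hQS)
  have hd : d₁ ≠ d₂ := fun heq => hPQ (heq ▸ rfl)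
  have hD : IsSkeletonFan K q {d₁, d₂} :=
    (isSkeletonFan_singleton h₂ (inSkeleton_of_isSplitBy h hS hsplit hcard h₂ hQS)).insert h₁
      (inSkeleton_of_isSplitBy h hS hsplit hcard h₁ hPS) (by simpa using hPQ)
  rw [areAligned_iff h₁ h₂ hPQ]
  constructor
  · intro hreg hdet
    have hc : (fun d : ℂ => if d = d₁ then Complex.normSq d₂ else
        -(d₁.re * d₂.re + d₁.im * d₂.im)) d₁ ≠ 0 := by
      simpa using h₂
    refine hD.not_isRegular h (c := fun d => if d = d₁ then Complex.normSq d₂ else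
      -(d₁.re * d₂.re + d₁.im * d₂.im)) ?_ ⟨d₁, by simp, hc⟩ hreg
    rw [Finset.sum_pair hd, if_pos rfl, if_neg hd.symm]
    simp only [planeDet] at hdet
    apply Complex.ext
    · simp only [Complex.real_smul, Complex.add_re, Complex.re_ofReal_mul, Complex.normSq_apply,
        Complex.zero_re]
      linear_combination d₂.im * hdet
    · simp only [Complex.real_smul, Complex.add_im, Complex.im_ofReal_mul, Complex.normSq_apply,
        Complex.zero_im]
      linear_combination (-d₂.re) * hdet
  · intro hdet
    by_contra hreg
    obtain ⟨w, hw, hws, hw1, hw2⟩ := exists_inSkeleton_of_not_isRegular h hreg hdet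
    have hD' := hD.insert hw hws (by simpa using ⟨hw1, hw2⟩)
    have hcard3 : (insert w ({d₁, d₂} : Finset ℂ)).card = 3 := by
      rw [Finset.card_insert_of_notMem, Finset.card_pair hd]
      simp only [Finset.mem_insert, Finset.mem_singleton, not_or]
      exact ⟨fun heq => hw1 (heq ▸ rfl), fun heq => hw2 (heq ▸ rfl)⟩
    have := hmax _ hD'.coe_image_subset (hD'.isSplitBy h (by omega))
    rw [hD'.card_image] at this
    omega

end Main

theorem mainTheorem5 (K : SimplicialComplex ℝ E3) (Ω : Set E3) (hK : IsTetMesh K Ω)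
    (q₀ : E3) (hq : q₀ ∈ K.vertices) (hqΩ : q₀ ∈ Ω) :
    ((∀ S : Finset (Set E3), (S : Set (Set E3)) ⊆ semiplaneFamily q₀ →
        ¬ IsSplitBy K (vertexMacro K q₀) S) →
      IsRegularP1P1P1bP1 K (vertexMacro K q₀)) ∧
    (∀ S : Finset (Set E3), (S : Set (Set E3)) ⊆ semiplaneFamily q₀ →
      IsSplitBy K (vertexMacro K q₀) S →
      (∀ S' : Finset (Set E3), (S' : Set (Set E3)) ⊆ semiplaneFamily q₀ →
        IsSplitBy K (vertexMacro K q₀) S' → S'.card ≤ 2) →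
      ∀ P Q : Set E3, P ≠ Q → (S : Set (Set E3)) = {P, Q} →
        (IsRegularP1P1P1bP1 K (vertexMacro K q₀) ↔ ¬ AreAligned q₀ P Q)) ∧
    (∀ S : Finset (Set E3), (S : Set (Set E3)) ⊆ semiplaneFamily q₀ →
      IsSplitBy K (vertexMacro K q₀) S → 2 < S.card →
      ¬ IsRegularP1P1P1bP1 K (vertexMacro K q₀)) := by
  have h := hK.isInteriorVertex hq hqΩ
  refine ⟨isRegular_of_not_isSplitBy h, fun S hS hsplit hmax P Q hPQ hSPQ =>
    isRegular_iff_not_areAligned h hPQ hSPQ hS hsplit hmax, fun S hS hsplit hcard => ?_⟩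
  obtain ⟨D, hD, hDcard⟩ := exists_isSkeletonFan_of_isSplitBy h hS hsplit hcard.le
  exact hD.not_isRegular_of_two_lt_card h (hDcard ▸ hcard)
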